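/- **Setting.** Let $(\mathbb X,\mathbb C,\|\cdot\|)$ and $(\mathbb B,\mathbb Y,\|\cdot\|)$ be dual pairs of normed real vector spaces: each pair carries a bilinear form $\langle\cdot,\cdot\rangle$ separating points on both sides, the first space is normed, and the dual norm $\|y\|_*:=\sup_{\|v\|\le 1}\langle v,y\rangle$ on the second space is finite. Let $\mathcal A:\mathbb X\to\mathbb B$ be linear and continuous for the weak topologies $\sigma(\mathbb X,\mathbb C)$, $\sigma(\mathbb B,\mathbb Y)$, let $\mathbb K\subset\mathbb B$ be a $\sigma(\mathbb B,\mathbb Y)$-closed convex cone containing $0$, with dual cone $\mathbb K^*=\{y\in\mathbb Y:\langle v,y\rangle\ge 0\ \forall v\in\mathbb K\}$, and let $b\in\mathbb B$, $c\in\mathbb C$. Assume that $\{y\in\mathbb K^*:\|y\|_*\le 1\}$ is $\sigma(\mathbb Y,\mathbb B)$-compact (this is automatic if $\mathbb Y$ is the full topological dual of $(\mathbb B,\|\cdot\|)$). Let $x_1,\dots,x_n\in\mathbb X$ be linearly independent with $\|x_i\|=1$, let $\|\cdot\|_{\mathfrak R}$ be a norm on $\mathbb R^n$ with dual norm $\|v\|_{\mathfrak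 R^*}=\sup_{\|\alpha\|_{\mathfrak R}\le 1}\alpha\cdot v$, let $\theta_{\mathcal P}\in\mathbb R$, and put $$\mathcal A_n\alpha=\sum_{i=1}^n\alpha_i\mathcal A x_i,\qquad \mathcal A_n^*y=\big(\langle \mathcal A x_i,y\rangle\big)_{i\le n},\qquad \mathbf c=\big(\langle x_i,c\rangle\big)_{i\le n}.$$ **Programs.** Let $$J_n=\inf\{\alpha\cdot\mathbf c:\ \mathcal A_n\alpha-b\in\mathbb K,\ \|\alpha\|_{\mathfrak R}\le\theta_{\mathcal P}\},$$ let $\mathcal K$ be the set of extreme points of $\{y\in\mathbb K^*:\|y\|_*=1\}$, let $\mathbb P$ be a probability measure concentrated on $\mathcal K$ (on a $\sigma$-algebra of $\mathbb Y$ for which all functionals $\langle d,\cdot\rangle$, $d\in\mathbb B$, are measurable, e.g. a Borel $\sigma$-algebra), and for i.i.d. samples $y_1,\dots,y_N\sim\mathbb P$ let $$J_{n,N}=\min\{\alpha\cdot\mathbf c:\ \alpha\cdot\mathcal A_n^*y_j\ge\langle b,y_j\rangle,\ j=1,\dots,N,\ \|\alpha\|_{\mathfrak R}\le\theta_{\mathcal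 P}\}$$ be the optimal value of the scenario program. Let $\alpha_N^\star$ denote its optimizer; if the optimizer is not unique, $\alpha^\star_N$ is the one that minimizes $\varphi$ among all optimizers, where $\varphi:\mathbb R^n\to\mathbb R$ is any fixed strictly convex function. **Regularity.** Assume that the program defining $J_n$ is feasible, and that there is $\gamma>0$ with $\|\mathcal A_n^*y\|_{\mathfrak R^*}\ge\gamma\|y\|_*$ for all $y\in\mathbb K^*$ and $\gamma\theta_{\mathcal P}>\|b\|$. For any lower bound $J_n^{\rm LB}\le J_n$ put $$\theta_{\mathcal D}=\frac{\theta_{\mathcal P}\|\mathbf c\|_{\mathfrak R^*}-J_n^{\rm LB}}{\gamma\theta_{\mathcal P}-\|b\|}.$$ **Notation.** For $\varepsilon\in[0,1]$ and $\beta\in(0,1)$ let $$\mathsf N(n,\varepsilon,\beta)=\min\Big\{N\in\mathbb N:\ \sum_{i=0}^{n-1}\binom Ni\varepsilon^i(1-\varepsilon)^{N-i}\le\beta\Big\}\qquad(\min\emptyset=\infty).$$ With $\sigma_{\mathcal K}(d)=\sup_{y\in\mathcal K}\langle d,y\rangle$ and $p(\alpha,\zeta)=\mathbb P\big[y:\sigma_{\mathcal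 K}(-\mathcal A_n\alpha+b)<\langle-\mathcal A_n\alpha+b,y\rangle+\zeta\big]$, a *tail bound* is a real function $h$ with $h(\alpha,\varepsilon)\ge\sup\{\zeta\ge 0:p(\alpha,\zeta)\le\varepsilon\}$ for all $\alpha\in\mathbb R^n$ and $\varepsilon\in[0,1)$. **Theorem (Randomized approximation error).** Let $\beta\in(0,1)$. 1. For every tail bound $h$, every $\varepsilon\in(0,1)$ and every $N\ge\mathsf N(n,\varepsilon,\beta)$, $$\mathbb P^N\big[\,0\le J_n-J_{n,N}\le\theta_{\mathcal D}\,h(\alpha_N^\star,\varepsilon)\,\big]\ge 1-\beta .$$ 2. Let $g:\mathbb R_+\to[0,1]$ be non-decreasing with $g(r)\le\mathbb P\big[\{y:\|y-\kappa\|_*<r\}\big]$ for all $\kappa\in\mathcal K$ and $r\ge 0$. Let $\varrho_n=\sup_{\|\alpha\|_{\mathfrak R}\le 1}\|\alpha\|_{\ell_1}$, assume $\|\mathcal A\|=\sup_{\|x\|\le 1}\|\mathcal A x\|<\infty$, and put $z_n=\big(\theta_{\mathcal D}(\theta_{\mathcal P}\varrho_n\|\mathcal A\|+\|b\|)\big)^{-1}$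 (with the convention $z_n=0$ if the expression in parentheses vanishes; no finite $N$ then satisfies the condition below). For every $\varepsilon>0$ and every $N\ge\mathsf N(n,g(z_n\varepsilon),\beta)$, $$\mathbb P^N\big[\,0\le J_n-J_{n,N}\le\varepsilon\,\big]\ge 1-\beta .$$ (An event is said to have probability at least $1-\beta$ if it contains a measurable set of probability at least $1-\beta$.) -/

import Mathlib

open MeasureTheory Set

noncomputable section

/-- The dual norm `‖y‖_* = sup {⟨e, y⟩ : ‖e‖ ≤ 1}` induced on `F` by the norm of `E` and a bilinear
form `p` on `E × F`. -/
def dualNorm {E F : Type*} [NormedAddCommGroup E] [NormedSpace ℝ E] [AddCommGroup F] [Module ℝ F]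
    (p : E →ₗ[ℝ] F →ₗ[ℝ] ℝ) (y : F) : ℝ :=
  sSup ((fun e : E => p e y) '' {e | ‖e‖ ≤ 1})

/-- `(E, F, ‖·‖)` is a dual pair of normed vector spaces: the bilinear form separates points on both
sides, and the supremum that defines the dual norm is finite. -/
structure IsDualPair {E F : Type*} [NormedAddCommGroup E] [NormedSpace ℝ E] [AddCommGroup F]
    [Module ℝ F] (p : E →ₗ[ℝ] F →ₗ[ℝ] ℝ) : Prop where
  separatingLeft : p.SeparatingLeft
  separatingRight : p.SeparatingRight
  bddAbove_dualNorm : ∀ y : F, BddAbove ((fun e : E => p e y) '' {e | ‖e‖ ≤ 1})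

/-- Closedness in the weak topology `σ(E, F)`. -/
def IsWeaklyClosed {E F : Type*} [AddCommGroup E] [Module ℝ E] [AddCommGroup F] [Module ℝ F]
    (p : E →ₗ[ℝ] F →ₗ[ℝ] ℝ) (S : Set E) : Prop :=
  @IsClosed E (WeakBilin.instTopologicalSpace p) S

/-- Compactness in the weak topology `σ(E, F)`. -/
def IsWeaklyCompact {E F : Type*} [AddCommGroup E] [Module ℝ E] [AddCommGroup F] [Module ℝ F]
    (p : E →ₗ[ℝ] F →ₗ[ℝ] ℝ) (S : Set E) : Prop :=
  @IsCompact E (WeakBilin.instTopologicalSpace p) S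

/-- Continuity of a linear operator for the weak topologies `σ(X, C)` and `σ(B, Y)`. -/
def IsWeaklyContinuous {X C B Y : Type*} [AddCommGroup X] [Module ℝ X] [AddCommGroup C] [Module ℝ C]
    [AddCommGroup B] [Module ℝ B] [AddCommGroup Y] [Module ℝ Y]
    (pX : X →ₗ[ℝ] C →ₗ[ℝ] ℝ) (pB : B →ₗ[ℝ] Y →ₗ[ℝ] ℝ) (A : X →ₗ[ℝ] B) : Prop :=
  @Continuous X B (WeakBilin.instTopologicalSpace pX) (WeakBilin.instTopologicalSpace pB) A

/-- The dual `‖v‖_{R*} = sup {α · v : ‖α‖_R ≤ 1}` of a norm `R` on `ℝⁿ`. -/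
def dualNormRn {n : ℕ} (R : Seminorm ℝ (Fin n → ℝ)) (v : Fin n → ℝ) : ℝ :=
  sSup ((fun α : Fin n → ℝ => α ⬝ᵥ v) '' {α | R α ≤ 1})

/-- The ratio `ϱ_n = sup {‖α‖_{ℓ₁} : ‖α‖_R ≤ 1}`. -/
def ratioConst {n : ℕ} (R : Seminorm ℝ (Fin n → ℝ)) : ℝ :=
  sSup ((fun α : Fin n → ℝ => ∑ i, |α i|) '' {α | R α ≤ 1})

/-- The values `‖A x‖` over the unit ball; their supremum is the operator norm. -/
def opNormValues {X B : Type*} [NormedAddCommGroup X] [NormedSpace ℝ X] [NormedAddCommGroup B]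
    [NormedSpace ℝ B] (A : X →ₗ[ℝ] B) : Set ℝ :=
  (fun x : X => ‖A x‖) '' {x | ‖x‖ ≤ 1}

/-- The operator norm `‖A‖ = sup {‖A x‖ : ‖x‖ ≤ 1}`. -/
def opNormSup {X B : Type*} [NormedAddCommGroup X] [NormedSpace ℝ X] [NormedAddCommGroup B]
    [NormedSpace ℝ B] (A : X →ₗ[ℝ] B) : ℝ :=
  sSup (opNormValues A)

/-- `A_n α = ∑ i, α_i A x_i`. -/
def opN {X B : Type*} [AddCommGroup X] [Module ℝ X] [AddCommGroup B] [Module ℝ B] {n : ℕ}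
    (A : X →ₗ[ℝ] B) (x : Fin n → X) (α : Fin n → ℝ) : B :=
  ∑ i, α i • A (x i)

/-- `A_n^* y = [⟨A x_1, y⟩, …, ⟨A x_n, y⟩]`. -/
def adjN {X B Y : Type*} [AddCommGroup X] [Module ℝ X] [AddCommGroup B] [Module ℝ B]
    [AddCommGroup Y] [Module ℝ Y] {n : ℕ} (pB : B →ₗ[ℝ] Y →ₗ[ℝ] ℝ) (A : X →ₗ[ℝ] B)
    (x : Fin n → X) (y : Y) : Fin n → ℝ :=
  fun i => pB (A (x i)) y

/-- The cost vector `𝐜 = [⟨x_1, c⟩, …, ⟨x_n, c⟩]`. -/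
def costVec {X C : Type*} [AddCommGroup X] [Module ℝ X] [AddCommGroup C] [Module ℝ C] {n : ℕ}
    (pX : X →ₗ[ℝ] C →ₗ[ℝ] ℝ) (x : Fin n → X) (c : C) : Fin n → ℝ :=
  fun i => pX (x i) c

/-- Feasible set of the semi-infinite program `(P_n)`. -/
def semiFeasible {X B : Type*} [AddCommGroup X] [Module ℝ X] [AddCommGroup B] [Module ℝ B] {n : ℕ}
    (A : X →ₗ[ℝ] B) (x : Fin n → X) (K : PointedCone ℝ B) (b : B) (R : Seminorm ℝ (Fin n → ℝ))
    (θP : ℝ) : Set (Fin n → ℝ) :=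
  {α | opN A x α - b ∈ K ∧ R α ≤ θP}

/-- Feasible set of the scenario program `(P_{n,N})` for the scenarios `ω 0, …, ω (N-1)`. -/
def scenFeasible {X B Y : Type*} [AddCommGroup X] [Module ℝ X] [AddCommGroup B] [Module ℝ B]
    [AddCommGroup Y] [Module ℝ Y] {n N : ℕ} (pB : B →ₗ[ℝ] Y →ₗ[ℝ] ℝ) (A : X →ₗ[ℝ] B)
    (x : Fin n → X) (b : B) (R : Seminorm ℝ (Fin n → ℝ)) (θP : ℝ) (ω : Fin N → Y) :
    Set (Fin n → ℝ) :=
  {α | (∀ j, pB b (ω j) ≤ α ⬝ᵥ adjN pB A x (ω j)) ∧ R α ≤ θP}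

/-- Optimal value of the program `min {α · c : α ∈ S}`. -/
def optValue {n : ℕ} (c : Fin n → ℝ) (S : Set (Fin n → ℝ)) : ℝ :=
  sInf ((fun α => α ⬝ᵥ c) '' S)

/-- `α` is an optimizer of the program `min {α · c : α ∈ S}`. -/
def IsOptimizer {n : ℕ} (c : Fin n → ℝ) (S : Set (Fin n → ℝ)) (α : Fin n → ℝ) : Prop :=
  α ∈ S ∧ ∀ α' ∈ S, α ⬝ᵥ c ≤ α' ⬝ᵥ c

/-- `α` is the optimizer of `min {α · c : α ∈ S}` selected by the tie-break rule `φ`: among all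
optimizers it minimizes `φ`. If the optimizer is unique, this is just the optimizer. -/
def IsSelectedOptimizer {n : ℕ} (φ : (Fin n → ℝ) → ℝ) (c : Fin n → ℝ) (S : Set (Fin n → ℝ))
    (α : Fin n → ℝ) : Prop :=
  IsOptimizer c S α ∧ ∀ α', IsOptimizer c S α' → φ α ≤ φ α'

/-- The set `𝒦` of extreme points of `{y ∈ K^* : ‖y‖_* = 1}`. -/
def scenarioSet {B Y : Type*} [NormedAddCommGroup B] [NormedSpace ℝ B] [AddCommGroup Y] [Module ℝ Y]
    (pB : B →ₗ[ℝ] Y →ₗ[ℝ] ℝ) (K : PointedCone ℝ B) : Set Y :=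
  extremePoints ℝ {y | y ∈ PointedCone.dual pB (K : Set B) ∧ dualNorm pB y = 1}

/-- The support function `σ_S(d) = sup {⟨d, y⟩ : y ∈ S}`. -/
def supportFn {B Y : Type*} [AddCommGroup B] [Module ℝ B] [AddCommGroup Y] [Module ℝ Y]
    (pB : B →ₗ[ℝ] Y →ₗ[ℝ] ℝ) (S : Set Y) (d : B) : ℝ :=
  sSup ((fun y => pB d y) '' S)

/-- The function `p(α, ζ) = P[y : σ_𝒦(-A_n α + b) < ⟨-A_n α + b, y⟩ + ζ]`. -/
def tailProb {X B Y : Type*} [AddCommGroup X] [Module ℝ X] [NormedAddCommGroup B] [NormedSpace ℝ B]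
    [AddCommGroup Y] [Module ℝ Y] [MeasurableSpace Y] {n : ℕ} (pB : B →ₗ[ℝ] Y →ₗ[ℝ] ℝ)
    (A : X →ₗ[ℝ] B) (x : Fin n → X) (K : PointedCone ℝ B) (b : B) (P : Measure Y)
    (α : Fin n → ℝ) (ζ : ℝ) : ℝ :=
  P.real {y | supportFn pB (scenarioSet pB K) (-opN A x α + b) < pB (-opN A x α + b) y + ζ}

/-- `h` is a tail bound: `h(α, ε) ≥ sup {ζ ≥ 0 : p(α, ζ) ≤ ε}` for all `α` and `ε ∈ [0, 1)`. (For
`ε = 1` the supremum is infinite.) -/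
def IsTailBound {X B Y : Type*} [AddCommGroup X] [Module ℝ X] [NormedAddCommGroup B]
    [NormedSpace ℝ B] [AddCommGroup Y] [Module ℝ Y] [MeasurableSpace Y] {n : ℕ}
    (pB : B →ₗ[ℝ] Y →ₗ[ℝ] ℝ) (A : X →ₗ[ℝ] B) (x : Fin n → X) (K : PointedCone ℝ B) (b : B)
    (P : Measure Y) (h : (Fin n → ℝ) → ℝ → ℝ) : Prop :=
  ∀ α, ∀ ε ∈ Ico (0 : ℝ) 1, h α ε ∈ upperBounds {ζ | 0 ≤ ζ ∧ tailProb pB A x K b P α ζ ≤ ε}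

/-- `g` is a non-decreasing function `ℝ₊ → [0, 1]` that bounds from below the measure of every open
ball (for the dual norm) centered in `𝒦`. -/
structure IsBallBound {B Y : Type*} [NormedAddCommGroup B] [NormedSpace ℝ B] [AddCommGroup Y]
    [Module ℝ Y] [MeasurableSpace Y] (pB : B →ₗ[ℝ] Y →ₗ[ℝ] ℝ) (K : PointedCone ℝ B)
    (P : Measure Y) (g : ℝ → ℝ) : Prop where
  mem_Icc : ∀ r, 0 ≤ r → g r ∈ Icc (0 : ℝ) 1
  mono : MonotoneOn g (Ici 0)
  le_measure_ball : ∀ κ ∈ scenarioSet pB K, ∀ r, 0 ≤ r →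
    ENNReal.ofReal (g r) ≤ P {y | dualNorm pB (y - κ) < r}

/-- `𝖭(n, ε, β)`, the least `N` with `∑_{i<n} C(N,i) ε^i (1-ε)^(N-i) ≤ β`; it is `⊤` if there is no
such `N`. -/
def sampleSize (n : ℕ) (ε β : ℝ) : ℕ∞ :=
  ⨅ N ∈ {N : ℕ | ∑ i ∈ Finset.range n, (N.choose i : ℝ) * ε ^ i * (1 - ε) ^ (N - i) ≤ β}, (N : ℕ∞)

/-- The event `S` has probability at least `q`. No measurability of `S` is presupposed: `S` has to
contain a measurable set of probability at least `q`. -/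
def HasProbAtLeast {Ω : Type*} [MeasurableSpace Ω] (μ : Measure Ω) (S : Set Ω) (q : ℝ) : Prop :=
  ∃ T ⊆ S, MeasurableSet T ∧ ENNReal.ofReal q ≤ μ T

/-- `θ_D = (θ_P ‖𝐜‖_{R*} - J_n^LB) / (γ θ_P - ‖b‖)`. -/
def thetaD {n : ℕ} (R : Seminorm ℝ (Fin n → ℝ)) (cvec : Fin n → ℝ) (θP γ JLB normb : ℝ) : ℝ :=
  (θP * dualNormRn R cvec - JLB) / (γ * θP - normb)

end

/-!
The proof combines the exact scenario bound for convex programs with a duality estimate for the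
semi-infinite program.

*Scenario bound.* For a program with `n` decision variables and `N` independent constraints, the
probability that the optimizer violates a further constraint with probability larger than `ε` is at
most the binomial tail `binomTail n N ε`. By Helly's theorem at most `n` of the sampled constraints
determine the optimizer (`ScenarioProgram.exists_support`). Suppose first that the objective is
strictly convex, and that almost surely no constraint outside a subsample is active at the optimizer
for that subsample. Then the active constraints determine the optimizer. Filling them up with the
inactive ones of smallest random label gives, for every sample size `m ≥ n`, exactly one `n`-subset
that is compatible with the other `m - n` points
(`ScenarioProgram.existsUnique_compatible`). By exchangeability, the probability `q` that a further
point is compatible with `n` given ones satisfies `C(m, n) E[q ^ (m - n)] = 1` for all `m ≥ n`.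
These moments determine the law of `q`, which is a Beta law, and a union bound over the `n`-subsets
then gives precisely the binomial tail (`measure_compression_le`).

General position is obtained by relaxing each constraint by a small random amount, which serves as
the label too, and a linear objective with tie-break rule `φ` is the limit of the strictly convex
objectives `c + η φ`. Both limits are harmless because the violation probability is lower
semicontinuous (`ScenarioProgram.measure_violation_le`, `measure_violation_lt_le`).

*Duality.* The semi-infinite program has a compact domain, so separating its image from the cone
yields approximate dual multipliers (`exists_dual_certificate`). The inf-sup condition bounds their
norm by `θ_D`, up to an arbitrarily small error. So a point of the domain that violates the conic
constraint by at most `s`, in the sense `⟨b - A_n α, y⟩ ≤ s ‖y‖_*` on the dual cone, undercuts the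
optimal value by at most `θ_D s` (`optValue_le_add_thetaD_mul`). By the Krein-Milman theorem
it is enough to bound the violation on `𝒦` (`IsDualPair.pairing_le_mul_dualNorm`).

*Conclusion.* If the violation probability at the scenario optimizer is at most `ε`, a tail bound
dominates the largest violation on `𝒦` (`IsTailBound.max_supportFn_le`). For the a priori bound, a
violation that is too large at one point of `𝒦` persists on a ball of radius `r`, so the violation
probability is at least `g r` (`IsBallBound.le_measure_violation`). Here the scenario bound is
needed for the event that the violation probability is *at least* `g r`, which the continuity of the
binomial tail provides (`measure_violation_ge_le`).
-/

/-! ### The binomial tail -/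

/-- The binomial tail `P[Bin(N, ε) < n]`. -/
noncomputable def binomTail (n N : ℕ) (ε : ℝ) : ℝ :=
  ∑ i ∈ Finset.range n, (N.choose i : ℝ) * ε ^ i * (1 - ε) ^ (N - i)

theorem continuous_binomTail (n N : ℕ) : Continuous (binomTail n N) := by
  unfold binomTail
  fun_prop

theorem binomTail_zero {n : ℕ} (hn : 0 < n) (N : ℕ) : binomTail n N 0 = 1 := by
  obtain ⟨k, rfl⟩ := Nat.exists_eq_succ_of_ne_zero hn.ne'
  unfold binomTail
  rw [Finset.sum_range_succ', Finset.sum_eq_zero]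
  · simp
  · intro i _
    simp

theorem binomTail_one {n N : ℕ} (h : n ≤ N) : binomTail n N 1 = 0 := by
  unfold binomTail
  refine Finset.sum_eq_zero fun i hi => ?_
  have : N - i ≠ 0 := by
    have := Finset.mem_range.1 hi
    omega
  simp [this]

theorem binomTail_of_lt {n N : ℕ} (h : N < n) (ε : ℝ) : binomTail n N ε = 1 := by
  have h1 : binomTail n N ε = binomTail (N + 1) N ε := by
    unfold binomTail
    refine (Finset.sum_subset (Finset.range_mono h) fun i _ hi => ?_).symm
    have : N < i := by simpa [Nat.lt_succ_iff] using hi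
    simp [Nat.choose_eq_zero_of_lt this]
  have h2 := add_pow ε (1 - ε) N
  rw [add_sub_cancel, one_pow] at h2
  rw [h1, h2]
  exact Finset.sum_congr rfl fun i _ => by ring

/-- Conditioning on the first of `N + 1` trials. -/
theorem binomTail_succ_succ (n N : ℕ) (ε : ℝ) :
    binomTail (n + 1) (N + 1) ε
      = (1 - ε) * binomTail (n + 1) N ε + ε * binomTail n N ε := by
  have key : ∀ i, (N.choose i : ℝ) * ε ^ i * (1 - ε) ^ (N + 1 - i)
      = (1 - ε) * ((N.choose i : ℝ) * ε ^ i * (1 - ε) ^ (N - i)) := by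
    intro i
    rcases le_or_gt i N with h | h
    · rw [Nat.succ_sub h, pow_succ]
      ring
    · simp [Nat.choose_eq_zero_of_lt h]
  unfold binomTail
  rw [Finset.sum_range_succ', Finset.sum_range_succ' (n := n), mul_add, Finset.mul_sum,
    Finset.mul_sum, add_right_comm, ← Finset.sum_add_distrib]
  congr 1
  · refine Finset.sum_congr rfl fun i _ => ?_
    rw [← key, Nat.choose_succ_succ, Nat.add_sub_add_right]
    push_cast
    ring
  · rw [← key]
    simp

theorem binomTail_succ_le (n N : ℕ) {ε : ℝ} (h0 : 0 ≤ ε) (h1 : ε ≤ 1) :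
    binomTail n (N + 1) ε ≤ binomTail n N ε := by
  cases n with
  | zero => simp [binomTail]
  | succ n =>
    have : binomTail n N ε ≤ binomTail (n + 1) N ε := by
      unfold binomTail
      rw [Finset.sum_range_succ]
      have : 0 ≤ 1 - ε := by linarith
      have : 0 ≤ (N.choose n : ℝ) * ε ^ n * (1 - ε) ^ (N - n) := by positivity
      linarith
    rw [binomTail_succ_succ]
    nlinarith

theorem binomTail_antitone (n : ℕ) {ε : ℝ} (h0 : 0 ≤ ε) (h1 : ε ≤ 1) :
    Antitone fun N => binomTail n N ε :=
  antitone_nat_of_succ_le fun N => binomTail_succ_le n N h0 h1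

/-- The derivatives of the summands telescope. -/
theorem hasDerivAt_binomTail {n N : ℕ} (h : n ≤ N) (ε : ℝ) :
    HasDerivAt (binomTail n N)
      (-((N.choose n : ℝ) * (n * ε ^ (n - 1) * (1 - ε) ^ (N - n)))) ε := by
  induction n with
  | zero =>
    have : binomTail 0 N = fun _ => 0 := by
      funext ε
      simp [binomTail]
    rw [this]
    simpa using hasDerivAt_const ε (0 : ℝ)
  | succ n ih =>
    have h1 : binomTail (n + 1) N
        = fun ε => binomTail n N ε + (N.choose n : ℝ) * ε ^ n * (1 - ε) ^ (N - n) := by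
      funext ε
      exact Finset.sum_range_succ _ _
    have h2 : HasDerivAt (fun ε : ℝ => 1 - ε) (-1) ε := by
      simpa using (hasDerivAt_id ε).const_sub 1
    have h3 := ((((hasDerivAt_pow n ε).const_mul (N.choose n : ℝ))).mul (h2.pow (N - n)))
    rw [h1]
    refine ((ih (by omega)).add h3).congr_deriv ?_
    have h4 : ((N.choose (n + 1) : ℕ) : ℝ) * (n + 1) = N.choose n * ((N - n : ℕ) : ℝ) := by
      exact_mod_cast Nat.choose_succ_right_eq N n
    have h5 : N - n - 1 = N - (n + 1) := by omega
    rw [h5]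
    push_cast
    have h6 : (N.choose (n + 1) : ℝ) * ((n + 1) * ε ^ n * (1 - ε) ^ (N - (n + 1)))
      = N.choose n * ((N - n : ℕ) : ℝ) * ε ^ n * (1 - ε) ^ (N - (n + 1)) := by
      rw [← h4]
      ring
    rw [h6]
    simp only [Pi.pow_apply]
    ring

/-! ### Moments on the unit interval -/

open unitInterval in
/-- A finite measure on the unit interval is determined by its moments. -/
theorem Measure.ext_of_moments {ρ τ : Measure I} [IsFiniteMeasure ρ] [IsFiniteMeasure τ]
    (h : ∀ k : ℕ, ∫ x : I, (x : ℝ) ^ k ∂ρ = ∫ x : I, (x : ℝ) ^ k ∂τ) : ρ = τ := by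
  have hint : ∀ (m : Measure I) [IsFiniteMeasure m] (g : C(I, ℝ)), Integrable g m :=
    fun m _ g => BoundedContinuousFunction.integrable m (BoundedContinuousFunction.mkOfCompact g)
  have hpoly : ∀ p : Polynomial ℝ, ∫ x : I, p.eval (x : ℝ) ∂ρ = ∫ x : I, p.eval (x : ℝ) ∂τ := by
    intro p
    simp only [Polynomial.eval_eq_sum_range]
    have hi : ∀ (m : Measure I) [IsFiniteMeasure m] (i : ℕ),
        Integrable (fun x : I => p.coeff i * (x : ℝ) ^ i) m :=
      fun m _ i => hint m ⟨fun x : I => p.coeff i * (x : ℝ) ^ i, by fun_prop⟩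
    rw [integral_finsetSum _ fun i _ => hi ρ i, integral_finsetSum _ fun i _ => hi τ i]
    simp only [integral_const_mul, h]
  refine ext_of_forall_integral_eq_of_IsFiniteMeasure fun f => ?_
  have hclosed : IsClosed {g : C(I, ℝ) | ∫ x, g x ∂ρ = ∫ x, g x ∂τ} := by
    have hc : ∀ (m : Measure I) [IsFiniteMeasure m],
        Continuous fun g : C(I, ℝ) => ∫ x, g x ∂m := by
      intro m _
      refine (LipschitzWith.of_dist_le_mul (K := m.real univ |>.toNNReal) fun g g' => ?_).continuous
      rw [Real.coe_toNNReal _ measureReal_nonneg, dist_eq_norm,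
        ← integral_sub (hint m g) (hint m g'), mul_comm]
      refine norm_integral_le_of_norm_le_const (Filter.Eventually.of_forall fun x => ?_)
      rw [← dist_eq_norm]
      exact ContinuousMap.dist_apply_le_dist x
    exact isClosed_eq (hc ρ) (hc τ)
  have hmem : f.toContinuousMap ∈ (polynomialFunctions I).topologicalClosure := by
    rw [polynomialFunctions_closure_eq_top']
    trivial
  have hsub : (polynomialFunctions I : Set C(I, ℝ))
      ⊆ {g : C(I, ℝ) | ∫ x, g x ∂ρ = ∫ x, g x ∂τ} := by
    intro g hg
    obtain ⟨p, -, rfl⟩ := hg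
    simpa using hpoly p
  exact hclosed.closure_subset_iff.2 hsub hmem

open unitInterval in
/-- The law `n (1 - x)^(n-1) dx` on the unit interval. -/
noncomputable def betaLaw (n : ℕ) : Measure I :=
  (volume : Measure I).withDensity fun x => ENNReal.ofReal (n * (1 - (x : ℝ)) ^ (n - 1))

open unitInterval in
/-- By the fundamental theorem of calculus, since the integrand is the derivative of
`x ↦ binomTail n N (1 - x)`. -/
theorem betaLaw_lintegral_pow {n N : ℕ} (h : n ≤ N) (c : I) :
    (N.choose n : ENNReal) * ∫⁻ x in Iic c, ENNReal.ofReal ((x : ℝ) ^ (N - n)) ∂(betaLaw n)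
      = ENNReal.ofReal (binomTail n N (1 - c)) := by
  have hc := c.2
  set F : ℝ → ℝ := fun x => (N.choose n : ℝ) * (n * (1 - x) ^ (n - 1) * x ^ (N - n)) with hF
  have hFc : Continuous F := by fun_prop
  have hF0 : ∀ x ∈ Icc (0 : ℝ) c, 0 ≤ F x := by
    intro x hx
    have h1 : 0 ≤ 1 - x := by linarith [hx.2, hc.2]
    have h2 : 0 ≤ x := hx.1
    positivity
  have hftc : ∫ x in (0 : ℝ)..c, F x = binomTail n N (1 - c) := by
    have hd : ∀ x : ℝ, HasDerivAt (fun x => binomTail n N (1 - x)) (F x) x := by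
      intro x
      have h2 : HasDerivAt (fun x : ℝ => 1 - x) (-1) x := by
        simpa using (hasDerivAt_id x).const_sub 1
      refine ((hasDerivAt_binomTail h (1 - x)).comp x h2).congr_deriv ?_
      simp [hF]
    rw [intervalIntegral.integral_eq_sub_of_hasDerivAt (fun x _ => hd x)
      (hFc.intervalIntegrable _ _)]
    simp [binomTail_one h]
  have hmeas : Measurable fun x : I => ENNReal.ofReal (n * (1 - (x : ℝ)) ^ (n - 1)) := by
    fun_prop
  rw [betaLaw, setLIntegral_withDensity_eq_setLIntegral_mul _ hmeas (by fun_prop)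
    measurableSet_Iic, ← lintegral_const_mul _ (by fun_prop)]
  have hpt : ∀ x : I, (N.choose n : ENNReal) *
      ((fun x : I => ENNReal.ofReal (n * (1 - (x : ℝ)) ^ (n - 1))) *
        fun x : I => ENNReal.ofReal ((x : ℝ) ^ (N - n))) x = ENNReal.ofReal (F x) := by
    intro x
    have h1 : 0 ≤ 1 - (x : ℝ) := by linarith [x.2.2]
    have h2 : 0 ≤ (x : ℝ) := x.2.1
    rw [Pi.mul_apply, ← ENNReal.ofReal_mul (by positivity), ← ENNReal.ofReal_natCast,
      ← ENNReal.ofReal_mul (by positivity)]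
  have hset : (Iic c : Set I) = (fun x : I => (x : ℝ)) ⁻¹' Iic (c : ℝ) := by
    ext x
    simp
  simp only [hpt]
  rw [hset, unitInterval.measurePreserving_coe.setLIntegral_comp_preimage
    measurableSet_Iic (f := fun x => ENNReal.ofReal (F x)) (by fun_prop),
    Measure.restrict_restrict measurableSet_Iic]
  have hset2 : Iic (c : ℝ) ∩ I = Icc 0 (c : ℝ) := by
    ext x
    simp only [mem_inter_iff, mem_Iic, mem_Icc]
    constructor
    · rintro ⟨h1, h2, h3⟩
      exact ⟨h2, h1⟩
    · rintro ⟨h1, h2⟩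
      exact ⟨h2, h1, h2.trans hc.2⟩
  rw [hset2, ← ofReal_integral_eq_lintegral_ofReal (hFc.integrableOn_Icc)
    ((ae_restrict_iff' measurableSet_Icc).2 (Filter.Eventually.of_forall hF0)),
    integral_Icc_eq_integral_Ioc, ← intervalIntegral.integral_of_le hc.1, hftc]

open unitInterval in
theorem betaLaw_moment {n : ℕ} (hn : 0 < n) (k : ℕ) :
    ((n + k).choose n : ENNReal) * ∫⁻ x, ENNReal.ofReal ((x : ℝ) ^ k) ∂(betaLaw n) = 1 := by
  have := betaLaw_lintegral_pow (n := n) (N := n + k) (by omega) 1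
  have h1 : (Iic (1 : I)) = univ := by
    ext x
    simpa using unitInterval.le_one'
  rw [h1] at this
  simpa [binomTail_zero hn] using this

/-! ### Compression schemes -/

/-- The probability that the points in `I` lie in `S` and that each of the `m - n` remaining points
is related to them by `G`: given the points in `I`, the remaining ones are independent. -/
theorem measure_pi_forall_notMem {Z : Type*} [MeasurableSpace Z] (μ : Measure Z)
    [IsProbabilityMeasure μ] {n m : ℕ} (I : Finset (Fin m)) (hI : I.card = n)
    {G : Set ((Fin n → Z) × Z)} (hG : MeasurableSet G) {S : Set (Fin n → Z)}
    (hS : MeasurableSet S) :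
    (Measure.pi fun _ : Fin m => μ) {ω | ω ∘ I.orderEmbOfFin hI ∈ S ∧
        ∀ j ∉ I, (ω ∘ I.orderEmbOfFin hI, ω j) ∈ G}
      = ∫⁻ t in S, μ {z | (t, z) ∈ G} ^ (m - n) ∂(Measure.pi fun _ : Fin n => μ) := by
  set f : Fin n ≃ {j // j ∈ I} := (I.orderIsoOfFin hI).toEquiv with hf
  have h1 := measurePreserving_piEquivPiSubtypeProd (fun _ : Fin m => μ) (fun j => j ∈ I)
  rw [Subsingleton.elim (Subtype.fintype fun j => j ∈ I) (Finset.Subtype.fintype I)] at h1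
  have h2 : MeasurePreserving (MeasurableEquiv.piCongrLeft (fun _ : {j // j ∈ I} => Z) f)
      (Measure.pi fun _ : Fin n => μ) (Measure.pi fun _ : {j // j ∈ I} => μ) :=
    measurePreserving_piCongrLeft (fun _ : {j // j ∈ I} => μ) f
  have h3 := (h2.symm.prod (MeasurePreserving.id
    (Measure.pi fun _ : {j : Fin m // j ∉ I} => μ))).comp h1
  set W : Set ((Fin n → Z) × ({j : Fin m // j ∉ I} → Z)) :=
    {q | q.1 ∈ S ∧ ∀ j, (q.1, q.2 j) ∈ G} with hW
  have hWm : MeasurableSet W := by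
    refine (measurable_fst hS).inter ?_
    have : {q : (Fin n → Z) × ({j : Fin m // j ∉ I} → Z) | ∀ j, (q.1, q.2 j) ∈ G}
        = ⋂ j, (fun q => (q.1, q.2 j)) ⁻¹' G := by
      ext q
      simp
    change MeasurableSet {q : (Fin n → Z) × ({j : Fin m // j ∉ I} → Z) | ∀ j, (q.1, q.2 j) ∈ G}
    rw [this]
    refine MeasurableSet.iInter fun j => ?_
    have : Measurable fun q : (Fin n → Z) × ({j : Fin m // j ∉ I} → Z) => (q.1, q.2 j) := by
      fun_prop
    exact this hG
  have hpre : {ω : Fin m → Z | ω ∘ I.orderEmbOfFin hI ∈ S ∧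
      ∀ j ∉ I, (ω ∘ I.orderEmbOfFin hI, ω j) ∈ G}
      = (Prod.map (MeasurableEquiv.piCongrLeft (fun _ : {j // j ∈ I} => Z) f).symm id ∘
        MeasurableEquiv.piEquivPiSubtypeProd (fun _ : Fin m => Z) (fun j => j ∈ I)) ⁻¹' W := by
    ext ω
    simp only [hW, mem_preimage, mem_ofPred_eq, Subtype.forall]
    rfl
  rw [hpre, h3.measure_preimage hWm.nullMeasurableSet, Measure.prod_apply hWm,
    ← lintegral_indicator hS]
  refine lintegral_congr fun t => ?_
  by_cases ht : t ∈ S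
  · have : Prod.mk t ⁻¹' W = univ.pi fun _ : {j : Fin m // j ∉ I} => {z | (t, z) ∈ G} := by
      ext w
      simp [hW, ht]
    rw [this, Measure.pi_pi]
    simp [ht, hI]
  · have : Prod.mk t ⁻¹' W = ∅ := by
      ext w
      simp [hW, ht]
    simp [this, ht]

/-- A compression scheme of size exactly `n` generalizes as a fully supported scenario program:
if for every sample size `m ≥ n` almost surely exactly one `n`-subset `I` of the sample is
compatible (in the sense of `G`) with all other points of the sample, then the distribution of the
probability of compatibility is determined by its moments `1 / C(m, n)`, and the probability that an
`n`-subset is compatible with the sample while the probability of incompatibility exceeds `ε` is at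
most a binomial tail. -/
theorem measure_compression_le {Z : Type*} [MeasurableSpace Z] (μ : Measure Z)
    [IsProbabilityMeasure μ] {n : ℕ} (hn : 0 < n)
    {G : Set ((Fin n → Z) × Z)} (hG : MeasurableSet G)
    (huniq : ∀ m, n ≤ m → ∀ᵐ ω ∂(Measure.pi fun _ : Fin m => μ),
      ∃! I : {I : Finset (Fin m) // I.card = n},
        ∀ j ∉ I.1, (ω ∘ I.1.orderEmbOfFin I.2, ω j) ∈ G)
    {N : ℕ} (hN : n ≤ N) {ε : ℝ} (hε0 : 0 ≤ ε) (hε1 : ε ≤ 1) :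
    (Measure.pi fun _ : Fin N => μ) {ω | ∃ I : {I : Finset (Fin N) // I.card = n},
        (∀ j ∉ I.1, (ω ∘ I.1.orderEmbOfFin I.2, ω j) ∈ G) ∧
        ENNReal.ofReal ε < μ {z | (ω ∘ I.1.orderEmbOfFin I.2, z) ∉ G}}
      ≤ ENNReal.ofReal (binomTail n N ε) := by
  set g : (Fin n → Z) → unitInterval := fun t =>
    ⟨μ.real {z | (t, z) ∈ G}, measureReal_nonneg, measureReal_le_one⟩ with hg
  have hgm : Measurable g :=
    ((measurable_measure_prodMk_left hG).ennreal_toReal).subtype_mk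
  have hgG : ∀ t, μ {z | (t, z) ∈ G} = ENNReal.ofReal (g t) := fun t => by simp [hg]
  have hslice : ∀ t, MeasurableSet {z | (t, z) ∈ G} := fun t => measurable_prodMk_left hG
  set ρ : Measure unitInterval := (Measure.pi fun _ : Fin n => μ).map g with hρ
  have : IsProbabilityMeasure ρ := Measure.isProbabilityMeasure_map hgm.aemeasurable
  have hcard : ∀ m, Fintype.card {I : Finset (Fin m) // I.card = n} = m.choose n := fun m => by
    simp
  -- the moments of `ρ`
  have hmom : ∀ k, ((n + k).choose n : ENNReal) * ∫⁻ x, ENNReal.ofReal ((x : ℝ) ^ k) ∂ρ = 1 := by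
    intro k
    set A : {I : Finset (Fin (n + k)) // I.card = n} → Set (Fin (n + k) → Z) := fun I =>
      {ω | ∀ j ∉ I.1, (ω ∘ I.1.orderEmbOfFin I.2, ω j) ∈ G} with hA
    have hAm : ∀ I, MeasurableSet (A I) := by
      intro I
      have : A I = ⋂ j, ⋂ (_ : j ∉ I.1),
          (fun ω : Fin (n + k) → Z => (ω ∘ I.1.orderEmbOfFin I.2, ω j)) ⁻¹' G := by
        ext ω
        simp [hA]
      rw [this]
      refine MeasurableSet.iInter fun j => MeasurableSet.iInter fun _ => ?_
      have : Measurable fun ω : Fin (n + k) → Z => (ω ∘ I.1.orderEmbOfFin I.2, ω j) := by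
        unfold Function.comp
        fun_prop
      exact this hG
    have hval : ∀ I, (Measure.pi fun _ : Fin (n + k) => μ) (A I)
        = ∫⁻ x, ENNReal.ofReal ((x : ℝ) ^ k) ∂ρ := by
      intro I
      have h1 := measure_pi_forall_notMem μ I.1 I.2 hG MeasurableSet.univ
      simp only [mem_univ, true_and, Measure.restrict_univ] at h1
      rw [hA, h1, hρ, lintegral_map (by fun_prop) hgm]
      refine lintegral_congr fun t => ?_
      rw [hgG, ENNReal.ofReal_pow (g t).2.1, Nat.add_sub_cancel_left]
    have hsum : ∑ I, (Measure.pi fun _ : Fin (n + k) => μ) (A I) = 1 := by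
      have h1 : ∀ I, (Measure.pi fun _ : Fin (n + k) => μ) (A I)
          = ∫⁻ ω, (A I).indicator 1 ω ∂(Measure.pi fun _ : Fin (n + k) => μ) := fun I =>
        (lintegral_indicator_one (hAm I)).symm
      simp only [h1]
      rw [← lintegral_finsetSum _ fun I _ => measurable_one.indicator (hAm I)]
      rw [lintegral_congr_ae (g := fun _ => 1)]
      · simp
      · filter_upwards [huniq (n + k) (by omega)] with ω hω
        obtain ⟨I, hI, hI'⟩ := hω
        rw [Finset.sum_eq_single I]
        · exact indicator_of_mem (show ω ∈ A I from hI) _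
        · intro J _ hJ
          refine indicator_of_notMem (fun hmem : ω ∈ A J => hJ (hI' J hmem)) _
        · simp
    simp only [hval] at hsum
    rw [Finset.sum_const, Finset.card_univ, hcard, nsmul_eq_mul] at hsum
    exact hsum
  -- hence `ρ` is the Beta law
  have hfin : IsFiniteMeasure (betaLaw n) := by
    refine ⟨?_⟩
    have := betaLaw_moment hn 0
    simp at this
    simp [this]
  have hρβ : ρ = betaLaw n := by
    refine Measure.ext_of_moments fun k => ?_
    have hnn : ∀ (m : Measure unitInterval), 0 ≤ᵐ[m] fun x : unitInterval => (x : ℝ) ^ k :=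
      fun m => Filter.Eventually.of_forall fun x => pow_nonneg x.2.1 k
    rw [integral_eq_lintegral_of_nonneg_ae (hnn _) (by fun_prop),
      integral_eq_lintegral_of_nonneg_ae (hnn _) (by fun_prop)]
    congr 1
    have hne : ((n + k).choose n : ENNReal) ≠ 0 := by
      exact_mod_cast (Nat.choose_pos (by omega)).ne'
    have := (hmom k).trans (betaLaw_moment hn k).symm
    exact (ENNReal.mul_right_inj hne (ENNReal.natCast_ne_top _)).1 this
  -- union bound over the `n`-subsets
  set S : Set (Fin n → Z) := {t | ENNReal.ofReal ε < μ {z | (t, z) ∉ G}} with hS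
  set c : unitInterval := ⟨1 - ε, by linarith, by linarith⟩ with hc
  have hcompl : ∀ t, μ {z | (t, z) ∉ G} = 1 - μ {z | (t, z) ∈ G} := fun t =>
    prob_compl_eq_one_sub (hslice t)
  have hSm : MeasurableSet S := by
    have : Measurable fun t => μ {z | (t, z) ∉ G} := measurable_measure_prodMk_left hG.compl
    exact measurableSet_lt measurable_const this
  have hSsub : S ⊆ g ⁻¹' Iic c := by
    intro t ht
    rw [hS, mem_ofPred_eq, hcompl, hgG, ← ENNReal.ofReal_one, ← ENNReal.ofReal_sub _ (g t).2.1,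
      ENNReal.ofReal_lt_ofReal_iff_of_nonneg hε0] at ht
    change (g t : ℝ) ≤ 1 - ε
    linarith
  calc (Measure.pi fun _ : Fin N => μ) {ω | ∃ I : {I : Finset (Fin N) // I.card = n},
        (∀ j ∉ I.1, (ω ∘ I.1.orderEmbOfFin I.2, ω j) ∈ G) ∧
        ENNReal.ofReal ε < μ {z | (ω ∘ I.1.orderEmbOfFin I.2, z) ∉ G}}
      ≤ (Measure.pi fun _ : Fin N => μ) (⋃ I : {I : Finset (Fin N) // I.card = n},
          {ω | ω ∘ I.1.orderEmbOfFin I.2 ∈ S ∧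
            ∀ j ∉ I.1, (ω ∘ I.1.orderEmbOfFin I.2, ω j) ∈ G}) := by
        refine measure_mono fun ω hω => ?_
        obtain ⟨I, hI, hI'⟩ := hω
        exact mem_iUnion.2 ⟨I, hI', hI⟩
    _ ≤ ∑ I : {I : Finset (Fin N) // I.card = n}, (Measure.pi fun _ : Fin N => μ)
          {ω | ω ∘ I.1.orderEmbOfFin I.2 ∈ S ∧
            ∀ j ∉ I.1, (ω ∘ I.1.orderEmbOfFin I.2, ω j) ∈ G} := measure_iUnion_fintype_le _ _
    _ = ∑ _I : {I : Finset (Fin N) // I.card = n},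
          ∫⁻ t in S, ENNReal.ofReal ((g t : ℝ) ^ (N - n)) ∂(Measure.pi fun _ : Fin n => μ) := by
        refine Finset.sum_congr rfl fun I _ => ?_
        rw [measure_pi_forall_notMem μ I.1 I.2 hG hSm]
        refine lintegral_congr fun t => ?_
        rw [hgG, ENNReal.ofReal_pow (g t).2.1]
    _ = (N.choose n : ENNReal) *
          ∫⁻ t in S, ENNReal.ofReal ((g t : ℝ) ^ (N - n)) ∂(Measure.pi fun _ : Fin n => μ) := by
        rw [Finset.sum_const, Finset.card_univ, hcard, nsmul_eq_mul]
    _ ≤ (N.choose n : ENNReal) * ∫⁻ t in g ⁻¹' Iic c, ENNReal.ofReal ((g t : ℝ) ^ (N - n))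
          ∂(Measure.pi fun _ : Fin n => μ) := by
        gcongr
    _ = (N.choose n : ENNReal) *
          ∫⁻ x in Iic c, ENNReal.ofReal ((x : ℝ) ^ (N - n)) ∂(betaLaw n) := by
        rw [← hρβ, hρ, setLIntegral_map measurableSet_Iic (by fun_prop) hgm]
    _ = ENNReal.ofReal (binomTail n N ε) := by
        rw [betaLaw_lintegral_pow hN c]
        simp [hc]

/-! ### Scenario programs with a strictly convex objective -/

/-- A convex scenario program on `ℝⁿ` with a strictly convex objective `f`, a compact convex domain
`D`, and the linear constraint `b z ≤ α · a z` for each scenario `z`. Some point of `D` satisfies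
the constraints of all scenarios at once. -/
structure ScenarioProgram (n : ℕ) (Z : Type*) [MeasurableSpace Z] where
  /-- The deterministic domain. -/
  D : Set (Fin n → ℝ)
  /-- The normal of the half-space constraint. -/
  a : Z → Fin n → ℝ
  /-- The offset of the half-space constraint. -/
  b : Z → ℝ
  /-- The objective. -/
  f : (Fin n → ℝ) → ℝ
  isCompact : IsCompact D
  convex : Convex ℝ D
  measurable_a : Measurable a
  measurable_b : Measurable b
  strictConvexOn : StrictConvexOn ℝ univ f
  feasible : ∃ α ∈ D, ∀ z, b z ≤ α ⬝ᵥ a z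

namespace ScenarioProgram

variable {n : ℕ} {Z ι κ : Type*} [MeasurableSpace Z] (Q : ScenarioProgram n Z)

theorem continuous_f : Continuous Q.f :=
  Q.strictConvexOn.convexOn.locallyLipschitz.continuous

/-- The feasible set for the scenarios `ω i`. -/
def feas (ω : ι → Z) : Set (Fin n → ℝ) :=
  {α | α ∈ Q.D ∧ ∀ i, Q.b (ω i) ≤ α ⬝ᵥ Q.a (ω i)}

theorem feas_comp (ω : ι → Z) (e : κ → ι) : Q.feas ω ⊆ Q.feas (ω ∘ e) :=
  fun _ h => ⟨h.1, fun k => h.2 (e k)⟩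

theorem isCompact_feas (ω : ι → Z) : IsCompact (Q.feas ω) := by
  have h : Q.feas ω = Q.D ∩ ⋂ i, {α | Q.b (ω i) ≤ α ⬝ᵥ Q.a (ω i)} := by
    ext α
    simp [feas]
  rw [h]
  refine Q.isCompact.inter_right (isClosed_iInter fun i => ?_)
  exact isClosed_le continuous_const (by fun_prop)

theorem convex_halfSpace (v : Fin n → ℝ) (r : ℝ) : Convex ℝ {α : Fin n → ℝ | r ≤ α ⬝ᵥ v} := by
  intro α hα β hβ s t hs ht hst
  simp only [mem_ofPred_eq, add_dotProduct, smul_dotProduct, smul_eq_mul] at *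
  calc r = s * r + t * r := by rw [← add_mul, hst, one_mul]
    _ ≤ _ := by gcongr

theorem convex_feas (ω : ι → Z) : Convex ℝ (Q.feas ω) := by
  have h : Q.feas ω = Q.D ∩ ⋂ i, {α | Q.b (ω i) ≤ α ⬝ᵥ Q.a (ω i)} := by
    ext α
    simp [feas]
  rw [h]
  exact Q.convex.inter (convex_iInter fun i => convex_halfSpace _ _)

theorem exists_minimizer (ω : ι → Z) : ∃ α ∈ Q.feas ω, ∀ β ∈ Q.feas ω, Q.f α ≤ Q.f β := by
  obtain ⟨α, hα, h⟩ := Q.feasible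
  exact (Q.isCompact_feas ω).exists_isMinOn ⟨α, hα, fun i => h _⟩ Q.continuous_f.continuousOn

/-- The optimizer for the scenarios `ω i`. -/
noncomputable def sol (ω : ι → Z) : Fin n → ℝ :=
  (Q.exists_minimizer ω).choose

theorem sol_mem (ω : ι → Z) : Q.sol ω ∈ Q.feas ω :=
  (Q.exists_minimizer ω).choose_spec.1

theorem f_sol_le (ω : ι → Z) {β : Fin n → ℝ} (hβ : β ∈ Q.feas ω) : Q.f (Q.sol ω) ≤ Q.f β :=
  (Q.exists_minimizer ω).choose_spec.2 β hβ

/-- The optimizer is unique by strict convexity. -/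
theorem eq_sol {ω : ι → Z} {β : Fin n → ℝ} (hβ : β ∈ Q.feas ω) (h : Q.f β ≤ Q.f (Q.sol ω)) :
    β = Q.sol ω := by
  refine (Q.strictConvexOn.subset (subset_univ _) (Q.convex_feas ω)).eq_of_isMinOn ?_ ?_ hβ
    (Q.sol_mem ω)
  · exact fun γ hγ => h.trans (Q.f_sol_le ω hγ)
  · exact fun γ hγ => Q.f_sol_le ω hγ

theorem sol_comp_eq_of_mem {ω : ι → Z} {e : κ → ι} (h : Q.sol (ω ∘ e) ∈ Q.feas ω) :
    Q.sol (ω ∘ e) = Q.sol ω :=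
  Q.eq_sol h (Q.f_sol_le _ (Q.feas_comp ω e (Q.sol_mem ω)))

/-- Constraints that are inactive at the optimizer can be dropped. -/
theorem sol_comp_eq_of_inactive [Finite ι] {ω : ι → Z} {e : κ → ι}
    (h : ∀ i ∉ range e, Q.b (ω i) < Q.sol ω ⬝ᵥ Q.a (ω i)) : Q.sol (ω ∘ e) = Q.sol ω := by
  have hmem := Q.feas_comp ω e (Q.sol_mem ω)
  set x := Q.sol ω with hx
  set y := Q.sol (ω ∘ e) with hy
  refine (Q.eq_sol hmem ?_).symm
  by_contra! hlt
  -- a short step from `x` towards `y` stays feasible and decreases the objective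
  have hev : ∀ᶠ t in nhdsWithin (0 : ℝ) (Ioi 0), ∀ i ∉ range e,
      Q.b (ω i) < ((1 - t) • x + t • y) ⬝ᵥ Q.a (ω i) := by
    refine Filter.eventually_all.2 fun i => ?_
    by_cases hi : i ∈ range e
    · exact Filter.Eventually.of_forall fun t h => absurd hi h
    have hc : Continuous fun t : ℝ => ((1 - t) • x + t • y) ⬝ᵥ Q.a (ω i) := by fun_prop
    have h0 : Q.b (ω i) < ((1 - (0 : ℝ)) • x + (0 : ℝ) • y) ⬝ᵥ Q.a (ω i) := by
      simpa using h i hi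
    have := (hc.tendsto 0).eventually (lt_mem_nhds h0)
    filter_upwards [nhdsWithin_le_nhds this] with t ht _ using ht
  have hlt1 : ∀ᶠ t in nhdsWithin (0 : ℝ) (Ioi 0), t < 1 :=
    nhdsWithin_le_nhds (gt_mem_nhds zero_lt_one)
  obtain ⟨t, ht, ht1, ht0⟩ := (hev.and (hlt1.and self_mem_nhdsWithin)).exists
  have ht0 : 0 < t := ht0
  have hxy : (1 - t) • x + t • y ∈ Q.feas ω := by
    refine ⟨Q.convex (Q.sol_mem ω).1 (Q.sol_mem (ω ∘ e)).1 (by linarith) ht0.le (by ring), ?_⟩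
    intro i
    by_cases hi : i ∈ range e
    · obtain ⟨k, rfl⟩ := hi
      exact (Q.convex_feas (ω ∘ e) hmem (Q.sol_mem (ω ∘ e)) (by linarith) ht0.le (by ring)).2 k
    · exact (ht i hi).le
  have h1 := Q.f_sol_le ω hxy
  have h2 := Q.strictConvexOn.convexOn.2 (mem_univ x) (mem_univ y)
    (show 0 ≤ 1 - t by linarith) ht0.le (by ring)
  simp only [smul_eq_mul] at h2
  rw [← hx] at h1
  rw [← hy] at hlt
  nlinarith

/-- By Helly's theorem, at most `n` of the scenarios determine the optimizer. -/
theorem exists_support [Fintype ι] [DecidableEq ι] (ω : ι → Z) :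
    ∃ J : Finset ι, J.card ≤ n ∧ Q.sol (ω ∘ ((↑) : J → ι)) = Q.sol ω := by
  by_contra! hno
  have hlt : ∀ J : Finset ι, J.card ≤ n →
      Q.f (Q.sol (ω ∘ ((↑) : J → ι))) < Q.f (Q.sol ω) := by
    intro J hJ
    by_contra! hle
    exact hno J hJ (Q.eq_sol (Q.feas_comp ω _ (Q.sol_mem ω)) hle).symm
  set F : Option ι → Set (Fin n → ℝ) := fun o => o.elim {α ∈ Q.D | Q.f α < Q.f (Q.sol ω)}
    fun i => {α ∈ Q.D | Q.b (ω i) ≤ α ⬝ᵥ Q.a (ω i)} with hF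
  have hconv : ∀ o ∈ (Finset.univ : Finset (Option ι)), Convex ℝ (F o) := by
    rintro (_ | i) -
    · exact (Q.strictConvexOn.convexOn.subset (subset_univ _) Q.convex).convex_lt _
    · exact Q.convex.inter (convex_halfSpace _ _)
  have hne := Convex.helly_theorem' (𝕜 := ℝ) hconv (fun s _ hs => by
    rw [Module.finrank_fin_fun] at hs
    by_cases h0 : none ∈ s
    · set J : Finset ι := Finset.univ.filter fun i => some i ∈ s with hJ
      have hJc : J.card ≤ n := by
        have h1 : (J.map Function.Embedding.some).card ≤ (s.erase none).card := by
          refine Finset.card_le_card fun o ho => ?_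
          simp only [Finset.mem_map, hJ, Finset.mem_filter, Finset.mem_univ, true_and] at ho
          obtain ⟨i, hi, rfl⟩ := ho
          simp [hi]
        rw [Finset.card_map, Finset.card_erase_of_mem h0] at h1
        omega
      refine ⟨Q.sol (ω ∘ ((↑) : J → ι)), mem_iInter₂.2 fun o ho => ?_⟩
      cases o with
      | none => exact ⟨(Q.sol_mem _).1, hlt J hJc⟩
      | some i => exact ⟨(Q.sol_mem _).1, (Q.sol_mem (ω ∘ ((↑) : J → ι))).2 ⟨i, by simp [hJ, ho]⟩⟩
    · refine ⟨Q.sol ω, mem_iInter₂.2 fun o ho => ?_⟩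
      cases o with
      | none => exact absurd ho h0
      | some i => exact ⟨(Q.sol_mem _).1, (Q.sol_mem ω).2 i⟩)
  obtain ⟨α, hα⟩ := hne
  have hα' : ∀ o, α ∈ F o := fun o => mem_iInter₂.1 hα o (Finset.mem_univ o)
  have hαf : α ∈ Q.feas ω := ⟨(hα' none).1, fun i => (hα' (some i)).2⟩
  exact absurd (Q.f_sol_le ω hαf) (not_le.2 (hα' none).2)

/-- Feasibility of the scenarios with a given bound on the objective is a closed condition on the
data, since the domain is compact. -/
theorem measurableSet_exists_le [Finite ι] {F : Set (Fin n → ℝ)} (hF : IsClosed F) :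
    MeasurableSet {p : (ι → Z) × ℝ | ∃ α ∈ F, α ∈ Q.feas p.1 ∧ Q.f α ≤ p.2} := by
  have hcomp : CompactSpace ↥(Q.D ∩ F) := isCompact_iff_compactSpace.1 (Q.isCompact.inter_right hF)
  set W : Set (((ι → (Fin n → ℝ) × ℝ) × ℝ) × ↥(Q.D ∩ F)) :=
    {q | (∀ i, (q.1.1 i).2 ≤ q.2.1 ⬝ᵥ (q.1.1 i).1) ∧ Q.f q.2.1 ≤ q.1.2} with hW
  have hWc : IsClosed W := by
    have h1 : W = (⋂ i, {q | (q.1.1 i).2 ≤ q.2.1 ⬝ᵥ (q.1.1 i).1}) ∩ {q | Q.f q.2.1 ≤ q.1.2} := by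
      ext q
      simp [hW]
    rw [h1]
    have hf := Q.continuous_f
    refine (isClosed_iInter fun i => isClosed_le (by fun_prop) (by fun_prop)).inter
      (isClosed_le (by fun_prop) (by fun_prop))
  have himg := (isClosedMap_fst_of_compactSpace W hWc).measurableSet
  have hmeas : Measurable fun p : (ι → Z) × ℝ =>
      ((fun i => (Q.a (p.1 i), Q.b (p.1 i)), p.2) : (ι → (Fin n → ℝ) × ℝ) × ℝ) := by
    have ha := Q.measurable_a
    have hb := Q.measurable_b
    fun_prop
  convert hmeas himg using 1
  ext p
  constructor
  · rintro ⟨α, hαF, hα, hf⟩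
    exact ⟨(_, ⟨α, hα.1, hαF⟩), ⟨hα.2, hf⟩, rfl⟩
  · rintro ⟨⟨q, α⟩, ⟨h1, h2⟩, rfl⟩
    exact ⟨α.1, α.2.2, ⟨α.2.1, h1⟩, h2⟩

/-- The optimizer lies in a closed set `F` if and only if some feasible point of `F` has at most the
optimal value, so measurability follows from the closedness of such conditions. -/
theorem measurable_sol [Finite ι] : Measurable (Q.sol : (ι → Z) → Fin n → ℝ) := by
  have hval : Measurable fun ω : ι → Z => Q.f (Q.sol ω) := by
    refine measurable_of_Iic fun t => ?_
    have h := (Q.measurableSet_exists_le (ι := ι) isClosed_univ)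
    have h2 : Measurable fun ω : ι → Z => (ω, t) := by fun_prop
    convert h2 h using 1
    ext ω
    constructor
    · exact fun hω => ⟨Q.sol ω, mem_univ _, Q.sol_mem ω, hω⟩
    · rintro ⟨α, -, hα, hf⟩
      exact (Q.f_sol_le ω hα).trans hf
  refine measurable_of_isClosed fun F hF => ?_
  have h := Q.measurableSet_exists_le (ι := ι) hF
  have h2 : Measurable fun ω : ι → Z => (ω, Q.f (Q.sol ω)) := by fun_prop
  convert h2 h using 1
  ext ω
  constructor
  · exact fun hω => ⟨Q.sol ω, hω, Q.sol_mem ω, le_rfl⟩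
  · rintro ⟨α, hαF, hα, hf⟩
    rw [Q.eq_sol hα hf] at hαF
    exact hαF

end ScenarioProgram

/-! ### The scenario bound in general position -/

/-- Among finitely many points with distinct labels, the `k` smallest ones can be singled out. -/
theorem Finset.exists_subset_card_eq_forall_lt {ι : Type*} [DecidableEq ι] (u : ι → ℝ)
    (hu : Function.Injective u) (s : Finset ι) (k : ℕ) (hk : k ≤ s.card) :
    ∃ T ⊆ s, T.card = k ∧ ∀ i ∈ T, ∀ j ∈ s \ T, u i < u j := by
  induction k with
  | zero => exact ⟨∅, by simp⟩
  | succ k ih =>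
    obtain ⟨T, hTs, hTk, hT⟩ := ih (by omega)
    have hne : (s \ T).Nonempty := by
      rw [← Finset.card_pos, Finset.card_sdiff_of_subset hTs]
      omega
    obtain ⟨m, hm, hmin⟩ := (s \ T).exists_min_image u hne
    have hm' := Finset.mem_sdiff.1 hm
    refine ⟨insert m T, Finset.insert_subset hm'.1 hTs, by
      rw [Finset.card_insert_of_notMem hm'.2, hTk], fun i hi j hj => ?_⟩
    simp only [Finset.mem_sdiff, Finset.mem_insert, not_or] at hj
    have hj' : j ∈ s \ T := Finset.mem_sdiff.2 ⟨hj.1, hj.2.2⟩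
    rcases Finset.mem_insert.1 hi with rfl | hi
    · exact lt_of_le_of_ne (hmin j hj') fun h => hj.2.1 (hu h).symm
    · exact hT i hi j hj'

/-- An event that is null for each fixed value of the points in `J` does not occur at a point
outside `J`. -/
theorem ae_pi_notMem_of_forall_null {Z : Type*} [MeasurableSpace Z] (μ : Measure Z)
    [IsProbabilityMeasure μ] {m : ℕ} (J : Finset (Fin m)) {j : Fin m} (hj : j ∉ J)
    {W : Set ((J → Z) × Z)} (hW : MeasurableSet W) (hnull : ∀ t, μ {z | (t, z) ∈ W} = 0) :
    ∀ᵐ ω ∂(Measure.pi fun _ : Fin m => μ), (ω ∘ ((↑) : J → Fin m), ω j) ∉ W := by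
  have h1 := measurePreserving_piEquivPiSubtypeProd (fun _ : Fin m => μ) (fun j => j ∈ J)
  rw [Subsingleton.elim (Subtype.fintype fun j => j ∈ J) (Finset.Subtype.fintype J)] at h1
  have h2 := (MeasurePreserving.id (Measure.pi fun _ : J => μ)).prod
    (measurePreserving_eval (fun _ : {j // j ∉ J} => μ) ⟨j, hj⟩)
  have h3 := h2.comp h1
  have h4 : (Measure.pi fun _ : Fin m => μ) ((Prod.map id (Function.eval ⟨j, hj⟩) ∘
      MeasurableEquiv.piEquivPiSubtypeProd (fun _ : Fin m => Z) (fun j => j ∈ J)) ⁻¹' W) = 0 := by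
    rw [h3.measure_preimage hW.nullMeasurableSet, Measure.measure_prod_null hW]
    exact Filter.Eventually.of_forall hnull
  refine (ae_iff (p := fun ω : Fin m → Z => (ω ∘ ((↑) : J → Fin m), ω j) ∉ W)).2 ?_
  simp only [not_not]
  exact h4

namespace ScenarioProgram

variable {n : ℕ} {Z ι κ : Type*} [MeasurableSpace Z] (Q : ScenarioProgram n Z)

/-- A scenario `z` is compatible with the `n` scenarios `t i` and the labels `u` if its constraint
is inactive at the optimizer for `t`, and its label is larger than those of all `t i` whose
constraints are inactive too. -/
def compatible (u : Z → ℝ) : Set ((Fin n → Z) × Z) :=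
  {q | Q.b q.2 < Q.sol q.1 ⬝ᵥ Q.a q.2 ∧
    ∀ i, Q.b (q.1 i) < Q.sol q.1 ⬝ᵥ Q.a (q.1 i) → u (q.1 i) < u q.2}

theorem measurableSet_compatible {u : Z → ℝ} (hu : Measurable u) :
    MeasurableSet (Q.compatible u) := by
  have ha := Q.measurable_a
  have hb := Q.measurable_b
  have hs := Q.measurable_sol (ι := Fin n)
  have hdot : Measurable fun p : (Fin n → ℝ) × (Fin n → ℝ) => p.1 ⬝ᵥ p.2 :=
    (by fun_prop : Continuous fun p : (Fin n → ℝ) × (Fin n → ℝ) => p.1 ⬝ᵥ p.2).measurable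
  have h1 : MeasurableSet {q : (Fin n → Z) × Z | Q.b q.2 < Q.sol q.1 ⬝ᵥ Q.a q.2} := by
    refine measurableSet_lt (by fun_prop) ?_
    exact hdot.comp (by fun_prop : Measurable fun q : (Fin n → Z) × Z => (Q.sol q.1, Q.a q.2))
  have h2 : ∀ i, MeasurableSet {q : (Fin n → Z) × Z |
      Q.b (q.1 i) < Q.sol q.1 ⬝ᵥ Q.a (q.1 i)} := by
    intro i
    refine measurableSet_lt (by fun_prop) ?_
    exact hdot.comp (by fun_prop : Measurable fun q : (Fin n → Z) × Z => (Q.sol q.1, Q.a (q.1 i)))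
  have h3 : ∀ i, MeasurableSet {q : (Fin n → Z) × Z | u (q.1 i) < u q.2} :=
    fun i => measurableSet_lt (by fun_prop) (by fun_prop)
  have : Q.compatible u = {q : (Fin n → Z) × Z | Q.b q.2 < Q.sol q.1 ⬝ᵥ Q.a q.2} ∩
      ⋂ i, ({q : (Fin n → Z) × Z | Q.b (q.1 i) < Q.sol q.1 ⬝ᵥ Q.a (q.1 i)}ᶜ ∪
        {q : (Fin n → Z) × Z | u (q.1 i) < u q.2}) := by
    ext q
    simp only [compatible, mem_ofPred_eq, mem_inter_iff, mem_iInter, mem_union, mem_compl_iff,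
      imp_iff_not_or]
  rw [this]
  exact h1.inter (MeasurableSet.iInter fun i => (h2 i).compl.union (h3 i))

variable {Q} in
/-- A compatible `n`-subset of the sample has the same optimizer as the sample. -/
theorem sol_eq_of_forall_compatible {u : Z → ℝ} {m : ℕ} {ω : Fin m → Z} {I : Finset (Fin m)}
    {hI : I.card = n} (h : ∀ j ∉ I, (ω ∘ I.orderEmbOfFin hI, ω j) ∈ Q.compatible u) :
    Q.sol (ω ∘ I.orderEmbOfFin hI) = Q.sol ω := by
  refine Q.sol_comp_eq_of_mem ⟨(Q.sol_mem _).1, fun i => ?_⟩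
  by_cases hi : i ∈ I
  · rw [← Finset.mem_coe, ← Finset.range_orderEmbOfFin I hI] at hi
    obtain ⟨k, rfl⟩ := hi
    exact (Q.sol_mem (ω ∘ I.orderEmbOfFin hI)).2 k
  · exact (h i hi).1.le

variable {Q} in
/-- For a sample in general position, exactly one `n`-subset is compatible with the rest: the set of
active scenarios, filled up with the inactive ones that have the smallest labels. -/
theorem existsUnique_compatible {u : Z → ℝ} {m : ℕ} (hm : n ≤ m) {ω : Fin m → Z}
    (hinj : Function.Injective (u ∘ ω))
    (hgen : ∀ J : Finset (Fin m), ∀ j ∉ J,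
      Q.sol (ω ∘ ((↑) : J → Fin m)) ⬝ᵥ Q.a (ω j) ≠ Q.b (ω j)) :
    ∃! I : {I : Finset (Fin m) // I.card = n},
      ∀ j ∉ I.1, (ω ∘ I.1.orderEmbOfFin I.2, ω j) ∈ Q.compatible u := by
  classical
  refine existsUnique_of_exists_of_unique ?_ ?_
  · set act : Finset (Fin m) := {i | Q.sol ω ⬝ᵥ Q.a (ω i) = Q.b (ω i)} with hact
    have hstrict : ∀ i ∉ act, Q.b (ω i) < Q.sol ω ⬝ᵥ Q.a (ω i) := by
      intro i hi
      refine lt_of_le_of_ne ((Q.sol_mem ω).2 i) fun h => hi ?_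
      simp [hact, h]
    have hcard : act.card ≤ n := by
      obtain ⟨J, hJn, hJ⟩ := Q.exists_support ω
      refine (Finset.card_le_card fun i hi => ?_).trans hJn
      by_contra hiJ
      refine hgen J i hiJ ?_
      rw [hJ]
      simpa [hact] using hi
    obtain ⟨T, hTs, hTk, hT⟩ := Finset.exists_subset_card_eq_forall_lt (u ∘ ω) hinj actᶜ
      (n - act.card) (by rw [Finset.card_compl, Fintype.card_fin]; omega)
    have hdisj : Disjoint act T :=
      Finset.disjoint_left.2 fun i hi hiT => Finset.mem_compl.1 (hTs hiT) hi
    have hI : (act ∪ T).card = n := by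
      rw [Finset.card_union_of_disjoint hdisj]
      omega
    refine ⟨⟨act ∪ T, hI⟩, fun j hj => ?_⟩
    have hsol : Q.sol (ω ∘ (act ∪ T).orderEmbOfFin hI) = Q.sol ω := by
      refine Q.sol_comp_eq_of_inactive fun i hi => hstrict i fun hi' => hi ?_
      rw [Finset.range_orderEmbOfFin]
      simp [hi']
    simp only [Finset.mem_union, not_or] at hj
    refine ⟨?_, fun k hk => ?_⟩
    · simp only [hsol]
      exact hstrict j hj.1
    · simp only [hsol] at hk
      have hmem := Finset.orderEmbOfFin_mem (act ∪ T) hI k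
      rcases Finset.mem_union.1 hmem with h | h
      · have : Q.sol ω ⬝ᵥ Q.a (ω ((act ∪ T).orderEmbOfFin hI k))
            = Q.b (ω ((act ∪ T).orderEmbOfFin hI k)) := by
          simpa only [hact, Finset.mem_filter, Finset.mem_univ, true_and] using h
        exact absurd this hk.ne'
      · exact hT _ h j (Finset.mem_sdiff.2 ⟨Finset.mem_compl.2 hj.1, hj.2⟩)
  · -- a point of one set outside the other would have a label both smaller and larger than that of
    -- a point of the other set outside the first
    have key : ∀ I₁ I₂ : {I : Finset (Fin m) // I.card = n},
        (∀ j ∉ I₁.1, (ω ∘ I₁.1.orderEmbOfFin I₁.2, ω j) ∈ Q.compatible u) →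
        (∀ j ∉ I₂.1, (ω ∘ I₂.1.orderEmbOfFin I₂.2, ω j) ∈ Q.compatible u) →
        ∀ i ∈ I₁.1, i ∉ I₂.1 → ∀ j ∈ I₂.1, j ∉ I₁.1 → u (ω i) < u (ω j) := by
      intro I₁ I₂ h₁ h₂ i hi hi' j hj hj'
      obtain ⟨k, rfl⟩ : i ∈ range (I₁.1.orderEmbOfFin I₁.2) := by
        rw [Finset.range_orderEmbOfFin]
        exact hi
      refine (h₁ j hj').2 k ?_
      have := (h₂ _ hi').1
      simp only [sol_eq_of_forall_compatible h₁, sol_eq_of_forall_compatible h₂] at this ⊢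
      exact this
    intro I₁ I₂ h₁ h₂
    by_contra hne
    have hne' : I₁.1 ≠ I₂.1 := fun h => hne (Subtype.ext h)
    obtain ⟨i, hi, hi'⟩ : ∃ i ∈ I₁.1, i ∉ I₂.1 := by
      by_contra! hsub
      exact hne' (Finset.eq_of_subset_of_card_le hsub (by rw [I₁.2, I₂.2]))
    obtain ⟨j, hj, hj'⟩ : ∃ j ∈ I₂.1, j ∉ I₁.1 := by
      by_contra! hsub
      exact hne' (Finset.eq_of_subset_of_card_le hsub (by rw [I₁.2, I₂.2])).symm
    exact lt_asymm (key I₁ I₂ h₁ h₂ i hi hi' j hj hj') (key I₂ I₁ h₂ h₁ j hj hj' i hi hi')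

/-- The probability that a further scenario violates the constraint at `α`. -/
noncomputable def violation (μ : Measure Z) (α : Fin n → ℝ) : ENNReal :=
  μ {z | α ⬝ᵥ Q.a z < Q.b z}

theorem measurable_violation (μ : Measure Z) [SFinite μ] : Measurable (Q.violation μ) := by
  have ha := Q.measurable_a
  have hb := Q.measurable_b
  have hdot : Measurable fun p : (Fin n → ℝ) × (Fin n → ℝ) => p.1 ⬝ᵥ p.2 :=
    (by fun_prop : Continuous fun p : (Fin n → ℝ) × (Fin n → ℝ) => p.1 ⬝ᵥ p.2).measurable
  have : MeasurableSet {q : (Fin n → ℝ) × Z | q.1 ⬝ᵥ Q.a q.2 < Q.b q.2} := by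
    refine measurableSet_lt ?_ (by fun_prop)
    exact hdot.comp (by fun_prop : Measurable fun q : (Fin n → ℝ) × Z => (q.1, Q.a q.2))
  exact measurable_measure_prodMk_left this

/-- The scenario bound in general position: no constraint is active with positive probability at a
fixed point, and there is a label with a diffuse law. -/
theorem measure_violation_le_of_generic (μ : Measure Z) [IsProbabilityMeasure μ] (hn : 0 < n)
    (hgen : ∀ α, μ {z | α ⬝ᵥ Q.a z = Q.b z} = 0) {u : Z → ℝ} (hu : Measurable u)
    (hdiff : ∀ r, μ {z | u z = r} = 0) {N : ℕ} (hN : n ≤ N) {ε : ℝ} (hε0 : 0 ≤ ε) (hε1 : ε ≤ 1) :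
    (Measure.pi fun _ : Fin N => μ) {ω | ENNReal.ofReal ε < Q.violation μ (Q.sol ω)}
      ≤ ENNReal.ofReal (binomTail n N ε) := by
  have hdot : Measurable fun p : (Fin n → ℝ) × (Fin n → ℝ) => p.1 ⬝ᵥ p.2 :=
    (by fun_prop : Continuous fun p : (Fin n → ℝ) × (Fin n → ℝ) => p.1 ⬝ᵥ p.2).measurable
  have ha := Q.measurable_a
  have hb := Q.measurable_b
  have huniq : ∀ m, n ≤ m → ∀ᵐ ω ∂(Measure.pi fun _ : Fin m => μ),
      ∃! I : {I : Finset (Fin m) // I.card = n},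
        ∀ j ∉ I.1, (ω ∘ I.1.orderEmbOfFin I.2, ω j) ∈ Q.compatible u := by
    intro m hm
    have h1 : ∀ᵐ ω ∂(Measure.pi fun _ : Fin m => μ), ∀ J : Finset (Fin m), ∀ j, j ∉ J →
        Q.sol (ω ∘ ((↑) : J → Fin m)) ⬝ᵥ Q.a (ω j) ≠ Q.b (ω j) := by
      refine ae_all_iff.2 fun J => ae_all_iff.2 fun j => ?_
      by_cases hj : j ∈ J
      · exact Filter.Eventually.of_forall fun ω h => absurd hj h
      have hs := Q.measurable_sol (ι := J)
      have hW : MeasurableSet {q : (J → Z) × Z | Q.sol q.1 ⬝ᵥ Q.a q.2 = Q.b q.2} :=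
        measurableSet_eq_fun (hdot.comp
          (by fun_prop : Measurable fun q : (J → Z) × Z => (Q.sol q.1, Q.a q.2))) (by fun_prop)
      filter_upwards [ae_pi_notMem_of_forall_null μ J hj hW fun t => hgen (Q.sol t)] with ω hω _
      exact hω
    have h2 : ∀ᵐ ω ∂(Measure.pi fun _ : Fin m => μ), ∀ i j : Fin m, i ≠ j → u (ω i) ≠ u (ω j) := by
      refine ae_all_iff.2 fun i => ae_all_iff.2 fun j => ?_
      by_cases hij : i = j
      · exact Filter.Eventually.of_forall fun ω h => absurd hij h
      have hW : MeasurableSet {q : (({i} : Finset (Fin m)) → Z) × Z |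
          u (q.1 ⟨i, Finset.mem_singleton_self i⟩) = u q.2} :=
        measurableSet_eq_fun (by fun_prop) (by fun_prop)
      have hj : j ∉ ({i} : Finset (Fin m)) := by simpa using Ne.symm hij
      filter_upwards [ae_pi_notMem_of_forall_null μ {i} hj hW fun t => by
        simpa only [mem_ofPred_eq, eq_comm] using hdiff (u (t ⟨i, _⟩))] with ω hω _
      exact hω
    filter_upwards [h1, h2] with ω hω1 hω2
    refine existsUnique_compatible hm (fun i j hij => ?_) hω1
    by_contra hne
    exact hω2 i j hne hij
  refine le_trans (measure_mono_ae ?_)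
    (measure_compression_le μ hn (Q.measurableSet_compatible hu) huniq hN hε0 hε1)
  filter_upwards [huniq N hN] with ω hω hbad
  obtain ⟨I, hI, -⟩ := hω
  refine ⟨I, hI, lt_of_lt_of_le hbad (measure_mono fun z hz hz' => ?_)⟩
  have h1 := hz'.1
  simp only [sol_eq_of_forall_compatible hI] at h1
  exact lt_asymm h1 hz

end ScenarioProgram

/-! ### Removing the assumption of general position -/

theorem MapClusterPt.mem_of_isClosed {X Y : Type*} [TopologicalSpace X] {l : Filter Y} {f : Y → X}
    {x : X} (hx : MapClusterPt x l f) {C : Set X} (hC : IsClosed C) (h : ∀ᶠ y in l, f y ∈ C) :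
    x ∈ C := by
  rw [← hC.closure_eq]
  exact mem_closure_iff_clusterPt.2 (ClusterPt.mono hx (Filter.le_principal_iff.2 h))

/-- Lower semicontinuity of a measure along the lower limit of a sequence of sets, without any
measurability. -/
theorem eventually_lt_measure {Ω : Type*} [MeasurableSpace Ω] {μ : Measure Ω} {S : Set Ω}
    {s : ℕ → Set Ω} (h : ∀ ω ∈ S, ∀ᶠ k in Filter.atTop, ω ∈ s k) {r : ENNReal} (hr : r < μ S) :
    ∀ᶠ k in Filter.atTop, r < μ (s k) := by
  have hmono : Monotone fun j => ⋂ k ≥ j, s k :=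
    fun i j hij => biInter_subset_biInter_left fun k hk => le_trans hij hk
  have hsub : S ⊆ ⋃ j, ⋂ k ≥ j, s k := by
    intro ω hω
    obtain ⟨j, hj⟩ := Filter.eventually_atTop.1 (h ω hω)
    exact mem_iUnion.2 ⟨j, mem_iInter₂.2 hj⟩
  have h1 := hr.trans_le (measure_mono hsub)
  rw [hmono.measure_iUnion] at h1
  obtain ⟨j, hj⟩ := lt_iSup_iff.1 h1
  filter_upwards [Filter.eventually_ge_atTop j] with k hk
  exact hj.trans_le (measure_mono (biInter_subset_of_mem hk))

theorem measure_le_of_forall_eventually_mem {Ω : Type*} [MeasurableSpace Ω] {μ : Measure Ω}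
    {S : Set Ω} {s : ℕ → Set Ω} (h : ∀ ω ∈ S, ∀ᶠ k in Filter.atTop, ω ∈ s k) {r : ENNReal}
    (hr : ∀ k, μ (s k) ≤ r) : μ S ≤ r := by
  by_contra! hlt
  obtain ⟨k, hk⟩ := (eventually_lt_measure h hlt).exists
  exact absurd (hr k) (not_le.2 hk)

theorem measurable_const_dotProduct {n : ℕ} {Z : Type*} [MeasurableSpace Z] (α : Fin n → ℝ)
    {a : Z → Fin n → ℝ} (ha : Measurable a) : Measurable fun z => α ⬝ᵥ a z :=
  (by fun_prop : Continuous fun p : Fin n → ℝ => α ⬝ᵥ p).measurable.comp ha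

theorem tendsto_inv_natCast_add_one :
    Filter.Tendsto (fun k : ℕ => ((k : ℝ) + 1)⁻¹) Filter.atTop (nhds 0) := by
  simpa using tendsto_one_div_add_atTop_nhds_zero_nat (𝕜 := ℝ)

namespace ScenarioProgram

variable {n : ℕ} {Z ι κ : Type*} [MeasurableSpace Z] (Q : ScenarioProgram n Z)

/-- Each constraint is relaxed by an amount `u / (k + 1)`, where `u` is a further, uniformly
distributed component of the scenario. -/
noncomputable def relax (k : ℕ) : ScenarioProgram n (Z × unitInterval) where
  D := Q.D
  a q := Q.a q.1
  b q := Q.b q.1 - ((k : ℝ) + 1)⁻¹ * q.2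
  f := Q.f
  isCompact := Q.isCompact
  convex := Q.convex
  measurable_a := Q.measurable_a.comp measurable_fst
  measurable_b := by
    have hb := Q.measurable_b
    fun_prop
  strictConvexOn := Q.strictConvexOn
  feasible := by
    obtain ⟨α, hα, h⟩ := Q.feasible
    refine ⟨α, hα, fun q => ?_⟩
    have h1 : 0 ≤ ((k : ℝ) + 1)⁻¹ * q.2 := mul_nonneg (by positivity) q.2.2.1
    have h2 := h q.1
    linarith

/-- As the relaxation vanishes, the optimizers converge: a cluster point is feasible for the
unrelaxed constraints and at least as good as the optimizer, hence equal to it. -/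
theorem tendsto_sol_relax (ω : ι → Z × unitInterval) :
    Filter.Tendsto (fun k => (Q.relax k).sol ω) Filter.atTop
      (nhds (Q.sol fun i => (ω i).1)) := by
  refine Q.isCompact.tendsto_nhds_of_unique_mapClusterPt
    (Filter.Eventually.of_forall fun k => ((Q.relax k).sol_mem ω).1) fun x hx hcl => ?_
  refine Q.eq_sol ⟨hx, fun i => ?_⟩ ?_
  · refine le_of_forall_pos_le_add fun η hη => ?_
    have hC : IsClosed {α : Fin n → ℝ | Q.b (ω i).1 ≤ α ⬝ᵥ Q.a (ω i).1 + η} :=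
      isClosed_le continuous_const (by fun_prop)
    refine hcl.mem_of_isClosed hC ?_
    filter_upwards [tendsto_inv_natCast_add_one.eventually (gt_mem_nhds hη)] with k hk
    have h1 : Q.b (ω i).1 - ((k : ℝ) + 1)⁻¹ * (ω i).2 ≤ (Q.relax k).sol ω ⬝ᵥ Q.a (ω i).1 :=
      ((Q.relax k).sol_mem ω).2 i
    have h2 : ((k : ℝ) + 1)⁻¹ * (ω i).2 ≤ ((k : ℝ) + 1)⁻¹ :=
      mul_le_of_le_one_right (by positivity) (ω i).2.2.2
    change Q.b (ω i).1 ≤ (Q.relax k).sol ω ⬝ᵥ Q.a (ω i).1 + η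
    linarith
  · have hC : IsClosed {α : Fin n → ℝ | Q.f α ≤ Q.f (Q.sol fun i => (ω i).1)} :=
      isClosed_le Q.continuous_f continuous_const
    refine hcl.mem_of_isClosed hC (Filter.Eventually.of_forall fun k => ?_)
    refine (Q.relax k).f_sol_le ω ⟨(Q.sol_mem _).1, fun i => ?_⟩
    have h1 : 0 ≤ ((k : ℝ) + 1)⁻¹ * (ω i).2 := mul_nonneg (by positivity) (ω i).2.2.1
    have h2 := (Q.sol_mem fun i => (ω i).1).2 i
    change Q.b (ω i).1 - ((k : ℝ) + 1)⁻¹ * (ω i).2 ≤ (Q.sol fun i => (ω i).1) ⬝ᵥ Q.a (ω i).1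
    linarith

/-- The scenario bound without the assumption of general position. -/
theorem measure_violation_le (μ : Measure Z) [IsProbabilityMeasure μ] (hn : 0 < n)
    {N : ℕ} (hN : n ≤ N) {ε : ℝ} (hε0 : 0 ≤ ε) (hε1 : ε ≤ 1) :
    (Measure.pi fun _ : Fin N => μ) {ω | ENNReal.ofReal ε < Q.violation μ (Q.sol ω)}
      ≤ ENNReal.ofReal (binomTail n N ε) := by
  set μ' : Measure (Z × unitInterval) := μ.prod volume with hμ'
  have hnull : ∀ s : Set unitInterval, s.Subsingleton → (volume : Measure unitInterval) s = 0 :=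
    fun s hs => hs.measure_zero _
  have hgen : ∀ k α, μ' {q | α ⬝ᵥ (Q.relax k).a q = (Q.relax k).b q} = 0 := by
    intro k α
    rw [hμ', Measure.measure_prod_null (measurableSet_eq_fun
      (measurable_const_dotProduct α (Q.relax k).measurable_a) (Q.relax k).measurable_b)]
    refine Filter.Eventually.of_forall fun z => hnull _ fun u hu v hv => ?_
    have hu' : α ⬝ᵥ Q.a z = Q.b z - ((k : ℝ) + 1)⁻¹ * u := hu
    have hv' : α ⬝ᵥ Q.a z = Q.b z - ((k : ℝ) + 1)⁻¹ * v := hv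
    have h1 : ((k : ℝ) + 1)⁻¹ * (u : ℝ) = ((k : ℝ) + 1)⁻¹ * v := by linarith
    exact Subtype.ext (mul_left_cancel₀ (by positivity) h1)
  have hlabel : Measurable fun q : Z × unitInterval => (q.2 : ℝ) := by fun_prop
  have hdiff : ∀ r : ℝ, μ' {q | (q.2 : ℝ) = r} = 0 := by
    intro r
    rw [hμ', Measure.measure_prod_null (measurableSet_eq_fun hlabel measurable_const)]
    exact Filter.Eventually.of_forall fun z =>
      hnull _ fun u hu v hv => Subtype.ext (Eq.trans hu (Eq.symm hv))
  have hbound : ∀ k, (Measure.pi fun _ : Fin N => μ')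
      {ω | ENNReal.ofReal ε < (Q.relax k).violation μ' ((Q.relax k).sol ω)}
        ≤ ENNReal.ofReal (binomTail n N ε) := fun k =>
    (Q.relax k).measure_violation_le_of_generic μ' hn (hgen k) hlabel hdiff hN hε0 hε1
  have hpres : MeasurePreserving (fun (ω : Fin N → Z × unitInterval) i => (ω i).1)
      (Measure.pi fun _ : Fin N => μ') (Measure.pi fun _ : Fin N => μ) :=
    measurePreserving_pi _ _ fun _ => measurePreserving_fst
  have hm : MeasurableSet {ω : Fin N → Z | ENNReal.ofReal ε < Q.violation μ (Q.sol ω)} :=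
    measurableSet_lt measurable_const ((Q.measurable_violation μ).comp Q.measurable_sol)
  rw [← hpres.measure_preimage hm.nullMeasurableSet]
  refine measure_le_of_forall_eventually_mem (fun ω hω => ?_) hbound
  have ht := Q.tendsto_sol_relax ω
  -- the violation probability is lower semicontinuous along the relaxation
  have hω' : ENNReal.ofReal ε < μ' (Prod.fst ⁻¹'
      {z | (Q.sol fun i => (ω i).1) ⬝ᵥ Q.a z < Q.b z}) := by
    rw [hμ', measurePreserving_fst.measure_preimage]
    · exact hω
    · exact (measurableSet_lt (measurable_const_dotProduct _ Q.measurable_a)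
        Q.measurable_b).nullMeasurableSet
  refine eventually_lt_measure (fun q hq => ?_) hω'
  have hc : Continuous fun p : (Fin n → ℝ) => p ⬝ᵥ Q.a q.1 := by fun_prop
  have h1 := (hc.tendsto _).comp ht
  have h2 : Filter.Tendsto (fun k : ℕ => Q.b q.1 - ((k : ℝ) + 1)⁻¹ * q.2) Filter.atTop
      (nhds (Q.b q.1)) := by
    simpa using (tendsto_inv_natCast_add_one.mul_const (q.2 : ℝ)).const_sub (Q.b q.1)
  exact h1.eventually_lt h2 hq

end ScenarioProgram

/-! ### Linear objectives with a tie-break rule -/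

theorem IsOptimizer.convex {n : ℕ} {c : Fin n → ℝ} {S : Set (Fin n → ℝ)} (hS : Convex ℝ S) :
    Convex ℝ {α | IsOptimizer c S α} := by
  intro α hα β hβ s t hs ht hst
  refine ⟨hS hα.1 hβ.1 hs ht hst, fun γ hγ => ?_⟩
  rw [add_dotProduct, smul_dotProduct, smul_dotProduct, smul_eq_mul, smul_eq_mul]
  calc s * α ⬝ᵥ c + t * β ⬝ᵥ c ≤ s * γ ⬝ᵥ c + t * γ ⬝ᵥ c := by
        have := hα.2 γ hγ
        have := hβ.2 γ hγ
        gcongr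
    _ = γ ⬝ᵥ c := by rw [← add_mul, hst, one_mul]

/-- An optimizer that is at least as good for the tie-break rule is the selected one. -/
theorem IsSelectedOptimizer.unique {n : ℕ} {φ : (Fin n → ℝ) → ℝ} (hφ : StrictConvexOn ℝ univ φ)
    {c : Fin n → ℝ} {S : Set (Fin n → ℝ)} (hS : Convex ℝ S) {α β : Fin n → ℝ}
    (hα : IsSelectedOptimizer φ c S α) (hβ : IsOptimizer c S β) (hle : φ β ≤ φ α) : β = α :=
  (hφ.subset (subset_univ _) (IsOptimizer.convex hS)).eq_of_isMinOn
    (fun γ hγ => hle.trans (hα.2 γ hγ)) (fun γ hγ => hα.2 γ hγ) hβ hα.1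

theorem exists_isSelectedOptimizer {n : ℕ} {φ : (Fin n → ℝ) → ℝ} (hφ : Continuous φ)
    (c : Fin n → ℝ) {S : Set (Fin n → ℝ)} (hS : IsCompact S) (hne : S.Nonempty) :
    ∃ α, IsSelectedOptimizer φ c S α := by
  have hc : Continuous fun α : Fin n → ℝ => α ⬝ᵥ c := by fun_prop
  obtain ⟨α, hα, hmin⟩ := hS.exists_isMinOn hne hc.continuousOn
  have hT : IsCompact {β | IsOptimizer c S β} := by
    have : {β | IsOptimizer c S β} = S ∩ {β | β ⬝ᵥ c ≤ α ⬝ᵥ c} := by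
      ext β
      exact ⟨fun h => ⟨h.1, h.2 α hα⟩, fun h => ⟨h.1, fun γ hγ => h.2.trans (hmin hγ)⟩⟩
    rw [this]
    exact hS.inter_right (isClosed_le hc continuous_const)
  obtain ⟨β, hβ, hβmin⟩ := hT.exists_isMinOn ⟨α, hα, hmin⟩ hφ.continuousOn
  exact ⟨β, hβ, fun γ hγ => hβmin hγ⟩

/-- The scenario bound for a linear objective and an optimizer selected by a strictly convex
tie-break rule: the selected optimizer is the limit of the optimizers for the objectives
`c + φ / (k + 1)`. -/
theorem measure_violation_lt_le {Z : Type*} [MeasurableSpace Z] (μ : Measure Z)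
    [IsProbabilityMeasure μ] {n : ℕ} (hn : 0 < n) {D : Set (Fin n → ℝ)} (hDc : IsCompact D)
    (hD : Convex ℝ D) {a : Z → Fin n → ℝ} (ha : Measurable a) {b : Z → ℝ} (hb : Measurable b)
    {α₀ : Fin n → ℝ} (hα₀ : α₀ ∈ D) (hfeas : ∀ᵐ z ∂μ, b z ≤ α₀ ⬝ᵥ a z) (c : Fin n → ℝ)
    {φ : (Fin n → ℝ) → ℝ} (hφ : StrictConvexOn ℝ univ φ) {N : ℕ} (hN : n ≤ N)
    {α : (Fin N → Z) → Fin n → ℝ}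
    (hα : ∀ᵐ ω ∂(Measure.pi fun _ : Fin N => μ), IsSelectedOptimizer φ c
      {β | (∀ j, b (ω j) ≤ β ⬝ᵥ a (ω j)) ∧ β ∈ D} (α ω))
    {ε : ℝ} (hε0 : 0 ≤ ε) (hε1 : ε ≤ 1) :
    (Measure.pi fun _ : Fin N => μ) {ω | ENNReal.ofReal ε < μ {z | α ω ⬝ᵥ a z < b z}}
      ≤ ENNReal.ofReal (binomTail n N ε) := by
  classical
  have hφc : Continuous φ := hφ.convexOn.locallyLipschitz.continuous
  -- on a null set, the constraints are replaced by trivial ones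
  set E : Set Z := {z | b z ≤ α₀ ⬝ᵥ a z} with hE
  have hEm : MeasurableSet E := measurableSet_le hb (measurable_const_dotProduct α₀ ha)
  have hlin : ConvexOn ℝ univ fun α : Fin n → ℝ => α ⬝ᵥ c := by
    refine ⟨convex_univ, fun x _ y _ s t _ _ _ => ?_⟩
    simp [add_dotProduct, smul_dotProduct]
  set Q : ℕ → ScenarioProgram n Z := fun k =>
    { D := D
      a := E.indicator a
      b := E.indicator b
      f := fun α => ((k : ℝ) + 1)⁻¹ * φ α + α ⬝ᵥ c
      isCompact := hDc
      convex := hD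
      measurable_a := ha.indicator hEm
      measurable_b := hb.indicator hEm
      strictConvexOn := by
        refine StrictConvexOn.add_convexOn ?_ hlin
        refine ⟨convex_univ, fun x hx y hy hxy s t hs ht hst => ?_⟩
        have h1 := hφ.2 hx hy hxy hs ht hst
        have h2 : 0 < ((k : ℝ) + 1)⁻¹ := by positivity
        simp only [smul_eq_mul] at h1 ⊢
        nlinarith
      feasible := ⟨α₀, hα₀, fun z => by
        by_cases hz : z ∈ E
        · rw [indicator_of_mem hz, indicator_of_mem hz]
          exact hz
        · simp [indicator_of_notMem hz]⟩ } with hQ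
  have hall : ∀ᵐ ω ∂(Measure.pi fun _ : Fin N => μ), ∀ j, ω j ∈ E :=
    ae_all_iff.2 fun j => (measurePreserving_eval (fun _ : Fin N => μ) j).quasiMeasurePreserving.ae
      hfeas
  set good : Set (Fin N → Z) := {ω | (∀ j, ω j ∈ E) ∧ IsSelectedOptimizer φ c
      {β | (∀ j, b (ω j) ≤ β ⬝ᵥ a (ω j)) ∧ β ∈ D} (α ω)} with hgood
  have hgood_ae : ∀ᵐ ω ∂(Measure.pi fun _ : Fin N => μ), ω ∈ good := by
    filter_upwards [hall, hα] with ω h1 h2 using ⟨h1, h2⟩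
  -- a cluster point is feasible; it is optimal since the weight of `φ` vanishes, and it is at least
  -- as good for `φ` as the selected optimizer since each approximant is
  have htend : ∀ ω ∈ good, Filter.Tendsto (fun k => (Q k).sol ω) Filter.atTop (nhds (α ω)) := by
    rintro ω ⟨hωE, hsel⟩
    have hfe : ∀ k β, β ∈ (Q k).feas ω ↔ (∀ j, b (ω j) ≤ β ⬝ᵥ a (ω j)) ∧ β ∈ D := by
      intro k β
      simp only [ScenarioProgram.feas, hQ, mem_ofPred_eq, indicator_of_mem (hωE _)]
      exact and_comm
    have hconv : Convex ℝ {β | (∀ j, b (ω j) ≤ β ⬝ᵥ a (ω j)) ∧ β ∈ D} := by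
      convert (Q 0).convex_feas ω using 1
      ext β
      exact (hfe 0 β).symm
    refine hDc.tendsto_nhds_of_unique_mapClusterPt
      (Filter.Eventually.of_forall fun k => ((hfe k _).1 ((Q k).sol_mem ω)).2) fun x hx hcl => ?_
    have hle : ∀ k : ℕ, ((k : ℝ) + 1)⁻¹ * φ ((Q k).sol ω) + (Q k).sol ω ⬝ᵥ c
        ≤ ((k : ℝ) + 1)⁻¹ * φ (α ω) + α ω ⬝ᵥ c :=
      fun k => (Q k).f_sol_le ω ((hfe k _).2 hsel.1.1)
    have hfx : (∀ j, b (ω j) ≤ x ⬝ᵥ a (ω j)) ∧ x ∈ D := by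
      have hcl' := hcl.mem_of_isClosed ((Q 0).isCompact_feas ω).isClosed
        (Filter.Eventually.of_forall fun k => (hfe 0 _).2 ((hfe k _).1 ((Q k).sol_mem ω)))
      exact (hfe 0 x).1 hcl'
    have hφle : ∀ k, φ ((Q k).sol ω) ≤ φ (α ω) := by
      intro k
      have h1 := hle k
      have h2 := hsel.1.2 _ ((hfe k _).1 ((Q k).sol_mem ω))
      have h3 : 0 < ((k : ℝ) + 1)⁻¹ := by positivity
      by_contra! h4
      nlinarith
    obtain ⟨m, hm⟩ := (hDc.image hφc).bddBelow
    refine hsel.unique hφ hconv ⟨hfx, fun γ hγ => ?_⟩ ?_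
    · refine le_trans ?_ (hsel.1.2 γ hγ)
      refine le_of_forall_pos_le_add fun η hη => ?_
      have hC : IsClosed {β : Fin n → ℝ | β ⬝ᵥ c ≤ α ω ⬝ᵥ c + η} :=
        isClosed_le (by fun_prop) continuous_const
      refine hcl.mem_of_isClosed hC ?_
      have ht : Filter.Tendsto (fun k : ℕ => ((k : ℝ) + 1)⁻¹ * (φ (α ω) - m)) Filter.atTop
          (nhds 0) := by
        simpa using tendsto_inv_natCast_add_one.mul_const (φ (α ω) - m)
      filter_upwards [ht.eventually (gt_mem_nhds hη)] with k hk
      have h1 := hle k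
      have h2 : m ≤ φ ((Q k).sol ω) := hm ⟨_, ((hfe k _).1 ((Q k).sol_mem ω)).2, rfl⟩
      have h3 : 0 < ((k : ℝ) + 1)⁻¹ := by positivity
      change (Q k).sol ω ⬝ᵥ c ≤ α ω ⬝ᵥ c + η
      nlinarith
    · exact hcl.mem_of_isClosed (isClosed_le hφc continuous_const)
        (Filter.Eventually.of_forall hφle)
  have hbound : ∀ k, (Measure.pi fun _ : Fin N => μ)
      {ω | ENNReal.ofReal ε < (Q k).violation μ ((Q k).sol ω)}
        ≤ ENNReal.ofReal (binomTail n N ε) := fun k =>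
    (Q k).measure_violation_le μ hn hN hε0 hε1
  have hviol : ∀ k β, (Q k).violation μ β = μ {z | β ⬝ᵥ a z < b z} := by
    intro k β
    refine measure_congr ?_
    filter_upwards [hfeas] with z hz
    have hz' : z ∈ E := hz
    refine propext ?_
    change β ⬝ᵥ E.indicator a z < E.indicator b z ↔ β ⬝ᵥ a z < b z
    rw [indicator_of_mem hz', indicator_of_mem hz']
  calc (Measure.pi fun _ : Fin N => μ) {ω | ENNReal.ofReal ε < μ {z | α ω ⬝ᵥ a z < b z}}
      ≤ (Measure.pi fun _ : Fin N => μ)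
        {ω | ω ∈ good ∧ ENNReal.ofReal ε < μ {z | α ω ⬝ᵥ a z < b z}} := by
        refine measure_mono_ae ?_
        filter_upwards [hgood_ae] with ω h1 h2 using ⟨h1, h2⟩
    _ ≤ ENNReal.ofReal (binomTail n N ε) := by
        refine measure_le_of_forall_eventually_mem (fun ω hω => ?_) hbound
        have ht := htend ω hω.1
        simp only [mem_ofPred_eq, hviol]
        refine eventually_lt_measure (fun z hz => ?_) hω.2
        have hc : Continuous fun p : (Fin n → ℝ) => p ⬝ᵥ a z := by fun_prop
        exact ((hc.tendsto _).comp ht).eventually (gt_mem_nhds hz)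

/-- The scenario bound for the event that the violation probability is at least `ε`, by continuity
of the binomial tail. -/
theorem measure_violation_ge_le {Z : Type*} [MeasurableSpace Z] (μ : Measure Z)
    [IsProbabilityMeasure μ] {n : ℕ} (hn : 0 < n) {D : Set (Fin n → ℝ)} (hDc : IsCompact D)
    (hD : Convex ℝ D) {a : Z → Fin n → ℝ} (ha : Measurable a) {b : Z → ℝ} (hb : Measurable b)
    {α₀ : Fin n → ℝ} (hα₀ : α₀ ∈ D) (hfeas : ∀ᵐ z ∂μ, b z ≤ α₀ ⬝ᵥ a z) (c : Fin n → ℝ)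
    {φ : (Fin n → ℝ) → ℝ} (hφ : StrictConvexOn ℝ univ φ) {N : ℕ} (hN : n ≤ N)
    {α : (Fin N → Z) → Fin n → ℝ}
    (hα : ∀ᵐ ω ∂(Measure.pi fun _ : Fin N => μ), IsSelectedOptimizer φ c
      {β | (∀ j, b (ω j) ≤ β ⬝ᵥ a (ω j)) ∧ β ∈ D} (α ω))
    {ε : ℝ} (hε0 : 0 < ε) (hε1 : ε ≤ 1) :
    (Measure.pi fun _ : Fin N => μ) {ω | ENNReal.ofReal ε ≤ μ {z | α ω ⬝ᵥ a z < b z}}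
      ≤ ENNReal.ofReal (binomTail n N ε) := by
  have hc : Filter.Tendsto (fun e => ENNReal.ofReal (binomTail n N e)) (nhdsWithin ε (Iio ε))
      (nhds (ENNReal.ofReal (binomTail n N ε))) :=
    ((ENNReal.continuous_ofReal.comp (continuous_binomTail n N)).tendsto ε).mono_left
      nhdsWithin_le_nhds
  refine ge_of_tendsto hc ?_
  filter_upwards [self_mem_nhdsWithin, nhdsWithin_le_nhds (lt_mem_nhds hε0)] with e he he0
  have he' : e < ε := he
  refine le_trans (measure_mono fun ω hω => ?_) (measure_violation_lt_le μ hn hDc hD ha hb hα₀ hfeas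
    c hφ hN hα he0.le (he'.le.trans hε1))
  exact lt_of_lt_of_le ((ENNReal.ofReal_lt_ofReal_iff hε0).2 he') hω

/-! ### Dual pairs and the Krein-Milman theorem -/

section DualPair

variable {E F : Type*} [NormedAddCommGroup E] [NormedSpace ℝ E] [AddCommGroup F] [Module ℝ F]
  {p : E →ₗ[ℝ] F →ₗ[ℝ] ℝ}

theorem IsDualPair.le_dualNorm (hp : IsDualPair p) {e : E} (he : ‖e‖ ≤ 1) (y : F) :
    p e y ≤ dualNorm p y :=
  le_csSup (hp.bddAbove_dualNorm y) ⟨e, he, rfl⟩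

theorem dualNorm_le {y : F} {r : ℝ} (h : ∀ e : E, ‖e‖ ≤ 1 → p e y ≤ r) : dualNorm p y ≤ r := by
  refine csSup_le ⟨_, ⟨0, by simp, rfl⟩⟩ ?_
  rintro _ ⟨e, he, rfl⟩
  exact h e he

theorem IsDualPair.dualNorm_nonneg (hp : IsDualPair p) (y : F) : 0 ≤ dualNorm p y := by
  simpa using hp.le_dualNorm (e := 0) (by simp) y

theorem IsDualPair.pairing_le (hp : IsDualPair p) (e : E) (y : F) :
    p e y ≤ ‖e‖ * dualNorm p y := by
  rcases eq_or_ne e 0 with rfl | he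
  · simp
  have h0 : 0 < ‖e‖ := norm_pos_iff.2 he
  have h1 := hp.le_dualNorm (e := ‖e‖⁻¹ • e) (by simp [norm_smul, h0.ne']) y
  rw [map_smul, LinearMap.smul_apply, smul_eq_mul] at h1
  rwa [← inv_mul_le_iff₀ h0]

theorem IsDualPair.dualNorm_smul_le (hp : IsDualPair p) {r : ℝ} (hr : 0 ≤ r) (y : F) :
    dualNorm p (r • y) ≤ r * dualNorm p y := by
  refine dualNorm_le fun e he => ?_
  rw [map_smul, smul_eq_mul]
  exact mul_le_mul_of_nonneg_left (hp.le_dualNorm he y) hr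

theorem IsDualPair.dualNorm_smul (hp : IsDualPair p) {r : ℝ} (hr : 0 ≤ r) (y : F) :
    dualNorm p (r • y) = r * dualNorm p y := by
  rcases hr.eq_or_lt with rfl | hr'
  · refine le_antisymm (hp.dualNorm_smul_le le_rfl y) ?_
    simpa using hp.dualNorm_nonneg (0 : F)
  refine le_antisymm (hp.dualNorm_smul_le hr y) ?_
  have := hp.dualNorm_smul_le (inv_nonneg.2 hr) (r • y)
  rw [inv_smul_smul₀ hr'.ne'] at this
  rwa [← le_inv_mul_iff₀ hr']

theorem IsDualPair.eq_zero_of_dualNorm_eq_zero (hp : IsDualPair p) {y : F}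
    (hy : dualNorm p y = 0) : y = 0 := by
  refine hp.separatingRight y fun e => le_antisymm ?_ ?_
  · simpa [hy] using hp.pairing_le e y
  · simpa [hy] using hp.pairing_le (-e) y

theorem IsDualPair.dualNorm_add_le (hp : IsDualPair p) (y z : F) :
    dualNorm p (y + z) ≤ dualNorm p y + dualNorm p z := by
  refine dualNorm_le fun e he => ?_
  rw [map_add]
  exact add_le_add (hp.le_dualNorm he y) (hp.le_dualNorm he z)

theorem IsDualPair.t2Space_weakBilin_flip (hp : IsDualPair p) : T2Space (WeakBilin p.flip) := by
  refine (WeakBilin.isEmbedding (B := p.flip) ?_).t2Space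
  intro y z hyz
  have h : y - z = 0 := hp.separatingRight (y - z) fun e => by
    have := LinearMap.congr_fun hyz e
    rw [map_sub, sub_eq_zero]
    exact this
  exact sub_eq_zero.1 h

theorem IsDualPair.convex_dual_inter_ball (hp : IsDualPair p) (K : PointedCone ℝ E) :
    Convex ℝ {y | y ∈ PointedCone.dual p (K : Set E) ∧ dualNorm p y ≤ 1} := by
  intro y hy z hz s t hs ht hst
  refine ⟨?_, ?_⟩
  · intro v hv
    have h1 := hy.1 hv
    have h2 := hz.1 hv
    rw [map_add, map_smul, map_smul, smul_eq_mul, smul_eq_mul]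
    positivity
  · refine (hp.dualNorm_add_le _ _).trans ?_
    rw [hp.dualNorm_smul hs, hp.dualNorm_smul ht]
    have h1 := mul_le_mul_of_nonneg_left hy.2 hs
    have h2 := mul_le_mul_of_nonneg_left hz.2 ht
    linarith

theorem smul_mem_dual {K : PointedCone ℝ E} {y : F} (hy : y ∈ PointedCone.dual p (K : Set E))
    {r : ℝ} (hr : 0 ≤ r) : r • y ∈ PointedCone.dual p (K : Set E) := by
  intro v hv
  have := hy hv
  rw [map_smul, smul_eq_mul]
  positivity

/-- A nonzero extreme point of the unit ball of the dual cone has norm one, since otherwise it would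
lie strictly between zero and its normalization. -/
theorem IsDualPair.mem_scenarioSet_of_mem_extremePoints (hp : IsDualPair p) {K : PointedCone ℝ E}
    {y : F} (hy : y ∈ extremePoints ℝ
      {y | y ∈ PointedCone.dual p (K : Set E) ∧ dualNorm p y ≤ 1}) (hy0 : y ≠ 0) :
    y ∈ scenarioSet p K := by
  obtain ⟨⟨hyK, hy1⟩, hext⟩ := mem_extremePoints.1 hy
  have hpos : 0 < dualNorm p y :=
    lt_of_le_of_ne (hp.dualNorm_nonneg y) fun h => hy0 (hp.eq_zero_of_dualNorm_eq_zero h.symm)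
  have hone : dualNorm p y = 1 := by
    by_contra hne
    have hlt : dualNorm p y < 1 := lt_of_le_of_ne hy1 hne
    have h0 : (0 : F) ∈ {y | y ∈ PointedCone.dual p (K : Set E) ∧ dualNorm p y ≤ 1} := by
      refine ⟨Submodule.zero_mem _, ?_⟩
      have := hp.dualNorm_smul (le_refl (0 : ℝ)) y
      rw [zero_smul, zero_mul] at this
      rw [this]
      exact zero_le_one
    have h1 : (dualNorm p y)⁻¹ • y ∈
        {y | y ∈ PointedCone.dual p (K : Set E) ∧ dualNorm p y ≤ 1} := by
      refine ⟨smul_mem_dual hyK (inv_nonneg.2 hpos.le), ?_⟩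
      rw [hp.dualNorm_smul (inv_nonneg.2 hpos.le), inv_mul_cancel₀ hpos.ne']
    have hseg : y ∈ openSegment ℝ (0 : F) ((dualNorm p y)⁻¹ • y) := by
      refine ⟨1 - dualNorm p y, dualNorm p y, by linarith, hpos, by ring, ?_⟩
      rw [smul_zero, zero_add, smul_inv_smul₀ hpos.ne']
    exact hy0 (hext 0 h0 _ h1 hseg).1.symm
  refine mem_extremePoints.2 ⟨⟨hyK, hone⟩, fun z hz w hw => ?_⟩
  exact hext z ⟨hz.1, hz.2.le⟩ w ⟨hw.1, hw.2.le⟩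

/-- By the Krein-Milman theorem, an upper bound of a linear functional on `𝒦` extends to the dual
cone. -/
theorem IsDualPair.pairing_le_mul_dualNorm (hp : IsDualPair p) {K : PointedCone ℝ E}
    (hK : IsWeaklyCompact p.flip {y | y ∈ PointedCone.dual p (K : Set E) ∧ dualNorm p y ≤ 1})
    {d : E} {s : ℝ} (hs : 0 ≤ s) (h : ∀ y ∈ scenarioSet p K, p d y ≤ s) {y : F}
    (hy : y ∈ PointedCone.dual p (K : Set E)) : p d y ≤ s * dualNorm p y := by
  set U : Set F := {y | y ∈ PointedCone.dual p (K : Set E) ∧ dualNorm p y ≤ 1} with hU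
  have := hp.t2Space_weakBilin_flip
  have hUs : ∀ z ∈ U, p d z ≤ s := by
    have hKM := closure_convexHull_extremePoints (E := WeakBilin p.flip) (s := U) hK
      (hp.convex_dual_inter_ball K)
    have hclosed : IsClosed (X := WeakBilin p.flip) {z | p d z ≤ s} :=
      isClosed_le (WeakBilin.eval_continuous p.flip d) continuous_const
    have hconv : Convex ℝ (E := WeakBilin p.flip) {z | p d z ≤ s} := by
      intro z hz w hw a b ha hb hab
      have hlin : ∀ z w : F, p d (a • z + b • w) = a * p d z + b * p d w := fun z w => by
        rw [map_add, map_smul, map_smul, smul_eq_mul, smul_eq_mul]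
      have h2 := mul_le_mul_of_nonneg_left (show p d z ≤ s from hz) ha
      have h3 := mul_le_mul_of_nonneg_left (show p d w ≤ s from hw) hb
      refine (hlin z w).le.trans ?_
      calc a * p d z + b * p d w ≤ a * s + b * s := add_le_add h2 h3
        _ = s := by rw [← add_mul, hab, one_mul]
    have hsub : extremePoints ℝ (E := WeakBilin p.flip) U ⊆ {z | p d z ≤ s} := by
      intro z hz
      by_cases hz0 : z = (0 : F)
      · have : p d z = 0 := by rw [hz0, map_zero]
        exact this.le.trans hs
      · exact h z (hp.mem_scenarioSet_of_mem_extremePoints hz hz0)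
    have := closure_minimal (convexHull_min hsub hconv) hclosed
    rw [hKM] at this
    exact fun z hz => this hz
  rcases (hp.dualNorm_nonneg y).eq_or_lt with h0 | hpos
  · rw [hp.eq_zero_of_dualNorm_eq_zero h0.symm, map_zero]
    exact mul_nonneg hs (hp.dualNorm_nonneg _)
  · have h1 := hUs ((dualNorm p y)⁻¹ • y) ⟨smul_mem_dual hy (inv_nonneg.2 hpos.le), by
      rw [hp.dualNorm_smul (inv_nonneg.2 hpos.le), inv_mul_cancel₀ hpos.ne']⟩
    rw [map_smul, smul_eq_mul, inv_mul_le_iff₀ hpos] at h1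
    linarith

theorem IsDualPair.pairing_le_norm_of_mem_scenarioSet (hp : IsDualPair p) {K : PointedCone ℝ E}
    (d : E) {y : F} (hy : y ∈ scenarioSet p K) : p d y ≤ ‖d‖ := by
  have h1 := hp.pairing_le d y
  rwa [(mem_extremePoints.1 hy).1.2, mul_one] at h1

theorem IsDualPair.le_supportFn (hp : IsDualPair p) {K : PointedCone ℝ E} (d : E) {y : F}
    (hy : y ∈ scenarioSet p K) : p d y ≤ supportFn p (scenarioSet p K) d := by
  refine le_csSup ⟨‖d‖, ?_⟩ ⟨y, hy, rfl⟩
  rintro _ ⟨z, hz, rfl⟩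
  exact hp.pairing_le_norm_of_mem_scenarioSet d hz

end DualPair

/-! ### Norms on `ℝⁿ` -/

section FiniteDimensionalNorm

variable {n : ℕ} {R : Seminorm ℝ (Fin n → ℝ)}

theorem Seminorm.continuous_fin (R : Seminorm ℝ (Fin n → ℝ)) : Continuous R :=
  R.convexOn.locallyLipschitz.continuous

/-- A definite seminorm on `ℝⁿ` dominates a multiple of the sup norm, by compactness of the unit
sphere. -/
theorem Seminorm.isCompact_le (hR : ∀ α, R α = 0 → α = 0) (r : ℝ) : IsCompact {α | R α ≤ r} := by
  have hclosed : IsClosed {α | R α ≤ r} := isClosed_le R.continuous_fin continuous_const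
  refine Metric.isCompact_of_isClosed_isBounded hclosed ?_
  rcases (Metric.sphere (0 : Fin n → ℝ) 1).eq_empty_or_nonempty with he | hne
  · refine (Metric.isBounded_closedBall (x := (0 : Fin n → ℝ)) (r := 0)).subset fun α _ => ?_
    by_contra h0
    have hα : α ≠ 0 := fun h => h0 (by simp [h])
    have : ‖α‖⁻¹ • α ∈ Metric.sphere (0 : Fin n → ℝ) 1 := by
      simp [norm_smul, norm_ne_zero_iff.2 hα]
    rw [he] at this
    exact this
  · obtain ⟨α₀, hα₀, hmin⟩ := (isCompact_sphere (0 : Fin n → ℝ) 1).exists_isMinOn hne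
      R.continuous_fin.continuousOn
    have hm : 0 < R α₀ := by
      refine lt_of_le_of_ne (apply_nonneg R α₀) fun h => ?_
      have := hR α₀ h.symm
      simp [this] at hα₀
    refine (Metric.isBounded_closedBall (x := (0 : Fin n → ℝ)) (r := r / R α₀)).subset
      fun α hα => ?_
    rw [mem_closedBall_zero_iff, le_div_iff₀ hm]
    rcases eq_or_ne α 0 with rfl | h0
    · simpa using (apply_nonneg R 0).trans (show R 0 ≤ r from hα)
    have hpos : 0 < ‖α‖ := norm_pos_iff.2 h0
    have h1 : R α₀ ≤ R (‖α‖⁻¹ • α) := hmin (by simp [norm_smul, hpos.ne'])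
    rw [map_smul_eq_mul, norm_inv, norm_norm, le_inv_mul_iff₀ hpos] at h1
    exact h1.trans hα

theorem bddAbove_image_seminorm_le (hR : ∀ α, R α = 0 → α = 0) {f : (Fin n → ℝ) → ℝ}
    (hf : Continuous f) : BddAbove (f '' {α | R α ≤ 1}) :=
  ((Seminorm.isCompact_le hR 1).image hf).bddAbove

theorem Seminorm.inv_smul_le_one {r : ℝ} (hr : 0 < r) {α : Fin n → ℝ} (hα : R α ≤ r) :
    R (r⁻¹ • α) ≤ 1 := by
  rw [map_smul_eq_mul, norm_inv, Real.norm_of_nonneg hr.le, inv_mul_le_iff₀ hr, mul_one]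
  exact hα

theorem dotProduct_le_mul_dualNormRn (hR : ∀ α, R α = 0 → α = 0) {r : ℝ} (hr : 0 < r)
    {α : Fin n → ℝ} (hα : R α ≤ r) (v : Fin n → ℝ) : α ⬝ᵥ v ≤ r * dualNormRn R v := by
  have h1 : (r⁻¹ • α) ⬝ᵥ v ≤ dualNormRn R v :=
    le_csSup (bddAbove_image_seminorm_le hR (by fun_prop)) ⟨_, Seminorm.inv_smul_le_one hr hα, rfl⟩
  rwa [smul_dotProduct, smul_eq_mul, inv_mul_le_iff₀ hr] at h1

theorem dualNormRn_le {v : Fin n → ℝ} {r : ℝ} (h : ∀ α, R α ≤ 1 → α ⬝ᵥ v ≤ r) :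
    dualNormRn R v ≤ r := by
  refine csSup_le ⟨_, ⟨0, by simp, rfl⟩⟩ ?_
  rintro _ ⟨α, hα, rfl⟩
  exact h α hα

theorem sum_abs_le_mul_ratioConst (hR : ∀ α, R α = 0 → α = 0) {r : ℝ} (hr : 0 < r)
    {α : Fin n → ℝ} (hα : R α ≤ r) : ∑ i, |α i| ≤ r * ratioConst R := by
  have h1 : ∑ i, |(r⁻¹ • α) i| ≤ ratioConst R :=
    le_csSup (bddAbove_image_seminorm_le hR (f := fun α => ∑ i, |α i|) (by fun_prop))
      ⟨_, Seminorm.inv_smul_le_one hr hα, rfl⟩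
  simp only [Pi.smul_apply, smul_eq_mul, abs_mul, abs_inv, abs_of_pos hr, ← Finset.mul_sum] at h1
  rwa [inv_mul_le_iff₀ hr] at h1

end FiniteDimensionalNorm

/-! ### Duality for the semi-infinite program -/

section Duality

variable {X B Y : Type*} [NormedAddCommGroup X] [NormedSpace ℝ X]
  [NormedAddCommGroup B] [NormedSpace ℝ B] [AddCommGroup Y] [Module ℝ Y] {n : ℕ}

theorem pairing_opN (pB : B →ₗ[ℝ] Y →ₗ[ℝ] ℝ) (A : X →ₗ[ℝ] B) (x : Fin n → X) (α : Fin n → ℝ)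
    (y : Y) : pB (opN A x α) y = α ⬝ᵥ adjN pB A x y := by
  simp [opN, adjN, dotProduct, map_sum, LinearMap.sum_apply]

theorem opN_add_smul (A : X →ₗ[ℝ] B) (x : Fin n → X) (α β : Fin n → ℝ) (s t : ℝ) :
    opN A x (s • α + t • β) = s • opN A x α + t • opN A x β := by
  simp [opN, add_smul, mul_smul, Finset.sum_add_distrib, Finset.smul_sum]

theorem norm_opN_le {A : X →ₗ[ℝ] B} (hA : BddAbove (opNormValues A)) {x : Fin n → X}
    (hx : ∀ i, ‖x i‖ = 1) (α : Fin n → ℝ) : ‖opN A x α‖ ≤ (∑ i, |α i|) * opNormSup A := by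
  rw [Finset.sum_mul]
  refine norm_sum_le_of_le _ fun i _ => ?_
  rw [norm_smul, Real.norm_eq_abs]
  exact mul_le_mul_of_nonneg_left (le_csSup hA ⟨x i, (hx i).le, rfl⟩) (abs_nonneg _)

/-- Lagrangian duality for the semi-infinite program over a compact domain: if all feasible points
have objective value larger than `v`, then some `y` in the dual cone certifies this. The certificate
separates the compact image of the domain from the weakly closed cone `{r ≤ 0} × K`. -/
theorem exists_dual_certificate (pB : B →ₗ[ℝ] Y →ₗ[ℝ] ℝ) (A : X →ₗ[ℝ] B) (x : Fin n → X)
    {K : PointedCone ℝ B} (hK : IsWeaklyClosed pB (K : Set B)) (b : B) (c : Fin n → ℝ)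
    {D : Set (Fin n → ℝ)} (hDc : IsCompact D) (hD : Convex ℝ D)
    (hfeas : ∃ α ∈ D, opN A x α - b ∈ K) {v : ℝ}
    (hv : ∀ α ∈ D, opN A x α - b ∈ K → v < α ⬝ᵥ c) :
    ∃ y ∈ PointedCone.dual pB (K : Set B), ∀ α ∈ D, v + pB (opN A x α - b) y < α ⬝ᵥ c := by
  set G : (Fin n → ℝ) → ℝ × WeakBilin pB := fun α => (α ⬝ᵥ c - v, (opN A x α - b : B)) with hG
  have hGcont : Continuous G := by
    refine Continuous.prodMk (by fun_prop) ?_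
    refine WeakBilin.continuous_of_continuous_eval pB fun y => ?_
    have : (fun α => pB (opN A x α - b) y) = fun α => α ⬝ᵥ adjN pB A x y - pB b y := by
      funext α
      rw [map_sub, LinearMap.sub_apply, pairing_opN]
    change Continuous fun α => pB (opN A x α - b) y
    rw [this]
    fun_prop
  have hGconv : Convex ℝ (G '' D) := by
    rintro _ ⟨α, hα, rfl⟩ _ ⟨β, hβ, rfl⟩ s t hs ht hst
    refine ⟨s • α + t • β, hD hα hβ hs ht hst, ?_⟩
    refine Prod.ext ?_ ?_
    · change (s • α + t • β) ⬝ᵥ c - v = s * (α ⬝ᵥ c - v) + t * (β ⬝ᵥ c - v)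
      rw [add_dotProduct, smul_dotProduct, smul_dotProduct, smul_eq_mul, smul_eq_mul]
      linear_combination v * hst
    · change opN A x (s • α + t • β) - b = s • (opN A x α - b) + t • (opN A x β - b)
      have hb : b = s • b + t • b := by rw [← add_smul, hst, one_smul]
      rw [opN_add_smul, smul_sub, smul_sub]
      nth_rewrite 1 [hb]
      abel
  set KW : Set (WeakBilin pB) := (K : Set B) with hKW
  have hKc : IsClosed KW := hK
  set H : Set (ℝ × WeakBilin pB) := Iic (0 : ℝ) ×ˢ KW with hH
  have hHclosed : IsClosed H := isClosed_Iic.prod hKc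
  have hHconv : Convex ℝ H := by
    refine (convex_Iic 0).prod ?_
    intro k hk l hl s t hs ht _
    exact K.add_mem (K.smul_mem hs hk)
      (K.smul_mem ht hl)
  have hdisj : Disjoint (G '' D) H := by
    rw [Set.disjoint_left]
    rintro _ ⟨α, hα, rfl⟩ ⟨h1, h2⟩
    have h3 : α ⬝ᵥ c - v ≤ 0 := h1
    have := hv α hα h2
    linarith
  obtain ⟨f, u, w, hfu, huw, hwf⟩ := geometric_hahn_banach_compact_closed hGconv
    (hDc.image hGcont) hHconv hHclosed hdisj
  -- the functional is represented by a number and an element of `Y`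
  obtain ⟨y, hy⟩ := LinearMap.dualEmbedding_surjective pB
    (f.comp (ContinuousLinearMap.inr ℝ ℝ (WeakBilin pB)))
  set P : ℝ → B → ℝ × WeakBilin pB := fun r k => (r, k) with hP
  have hfy : ∀ k : B, f (P 0 k) = pB k y := fun k => (DFunLike.congr_fun hy k).symm
  set l := f (P 1 0) with hl
  have hfr : ∀ (r : ℝ) (k : B), f (P r k) = r * l + pB k y := by
    intro r k
    have h1 : P r k = r • P 1 0 + P 0 k := by
      refine Prod.ext ?_ ?_
      · change r = r * 1 + 0
        ring
      · change k = r • (0 : B) + k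
        rw [smul_zero, zero_add]
    rw [h1, map_add, map_smul, smul_eq_mul, hfy]
  have hw0 : w < 0 := by
    have := hwf (P 0 0) ⟨le_refl (0 : ℝ), K.zero_mem⟩
    rw [hfr] at this
    simpa using this
  -- on a cone, a linear functional that is bounded below is nonnegative
  have hcone : ∀ r ≤ (0 : ℝ), ∀ k ∈ K, 0 ≤ r * l + pB k y := by
    intro r hr k hk
    by_contra! hneg
    have ht : 0 ≤ w / (r * l + pB k y) := div_nonneg_of_nonpos hw0.le hneg.le
    have := hwf (P (w / (r * l + pB k y) * r) ((w / (r * l + pB k y)) • k))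
      ⟨mul_nonpos_of_nonneg_of_nonpos ht hr,
        K.smul_mem ht hk⟩
    rw [hfr, map_smul, LinearMap.smul_apply, smul_eq_mul, mul_assoc, ← mul_add,
      div_mul_cancel₀ _ hneg.ne] at this
    exact lt_irrefl _ this
  have hl0 : l ≤ 0 := by
    have := hcone (-1) (by norm_num) 0 K.zero_mem
    simp at this
    linarith
  have hyK : y ∈ PointedCone.dual pB (K : Set B) := by
    intro k hk
    simpa using hcone 0 le_rfl k hk
  have hlag : ∀ α ∈ D, (α ⬝ᵥ c - v) * l + pB (opN A x α - b) y < 0 := by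
    intro α hα
    have : f (P (α ⬝ᵥ c - v) (opN A x α - b)) < u := hfu (G α) ⟨α, hα, rfl⟩
    rw [hfr] at this
    linarith
  have hl_neg : l < 0 := by
    refine lt_of_le_of_ne hl0 fun h => ?_
    obtain ⟨α, hα, hαK⟩ := hfeas
    have h1 := hlag α hα
    have h2 : 0 ≤ pB (opN A x α - b) y := hyK hαK
    rw [h, mul_zero, zero_add] at h1
    linarith
  have hpos : 0 < -l := by linarith
  refine ⟨(-l)⁻¹ • y, smul_mem_dual hyK (inv_nonneg.2 hpos.le), fun α hα => ?_⟩
  have h1 := hlag α hα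
  have h2 : pB (opN A x α - b) y < (-l) * (α ⬝ᵥ c - v) := by linarith
  rw [← inv_mul_lt_iff₀ hpos] at h2
  rw [map_smul, smul_eq_mul]
  linarith

/-- Dual multipliers are bounded by `θ_D`, so a point of the domain that violates the conic
constraint by at most `s` undercuts the optimal value by at most `θ_D s`. -/
theorem optValue_le_add_thetaD_mul {pB : B →ₗ[ℝ] Y →ₗ[ℝ] ℝ} (hpB : IsDualPair pB)
    (A : X →ₗ[ℝ] B) (x : Fin n → X)
    {K : PointedCone ℝ B} (hK : IsWeaklyClosed pB (K : Set B)) (b : B) (c : Fin n → ℝ)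
    {R : Seminorm ℝ (Fin n → ℝ)} (hR : ∀ α, R α = 0 → α = 0) {θP : ℝ} (hθ : 0 < θP)
    (hfeas : (semiFeasible A x K b R θP).Nonempty) {γ : ℝ}
    (hinfsup : ∀ y ∈ PointedCone.dual pB (K : Set B),
      γ * dualNorm pB y ≤ dualNormRn R (adjN pB A x y))
    (hθP : ‖b‖ < γ * θP) {JLB : ℝ} (hJLB : JLB ≤ optValue c (semiFeasible A x K b R θP))
    {α : Fin n → ℝ} (hα : R α ≤ θP) {s : ℝ} (hs : 0 ≤ s)
    (hviol : ∀ y ∈ PointedCone.dual pB (K : Set B), pB (-opN A x α + b) y ≤ s * dualNorm pB y) :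
    optValue c (semiFeasible A x K b R θP) ≤ α ⬝ᵥ c + thetaD R c θP γ JLB ‖b‖ * s := by
  have hDc : IsCompact {α | R α ≤ θP} := Seminorm.isCompact_le hR θP
  have hD : Convex ℝ {α | R α ≤ θP} := by
    simpa using R.convexOn.convex_le θP
  set J := optValue c (semiFeasible A x K b R θP) with hJ
  set Δ := γ * θP - ‖b‖ with hΔ
  have hΔ0 : 0 < Δ := by linarith
  have hbdd : BddBelow ((fun α => α ⬝ᵥ c) '' semiFeasible A x K b R θP) := by
    refine (hDc.image (f := fun α => α ⬝ᵥ c) (by fun_prop)).bddBelow.mono ?_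
    exact image_mono fun α hα => hα.2
  have hstep : ∀ v < J, v ≤ (α ⬝ᵥ c + s * (θP * dualNormRn R c / Δ)) / (1 + s / Δ) := by
    intro v hv
    obtain ⟨y, hyK, hy⟩ := exists_dual_certificate pB A x hK b c hDc hD
      (by
        obtain ⟨α₀, h1, h2⟩ := hfeas
        exact ⟨α₀, h2, h1⟩)
      (v := v) (fun β hβ hβK => hv.trans_le (csInf_le hbdd ⟨β, ⟨hβK, hβ⟩, rfl⟩))
    have hby := hpB.pairing_le b y
    -- the certificate has norm at most `(θP ‖c‖ - v) / Δ`
    have hnorm : dualNorm pB y * Δ ≤ θP * dualNormRn R c - v := by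
      have h1 : dualNormRn R (adjN pB A x y)
          ≤ θP⁻¹ * (θP * dualNormRn R c - v + ‖b‖ * dualNorm pB y) := by
        refine dualNormRn_le fun β hβ => ?_
        have hβ' : R (θP • β) ≤ θP := by
          rw [map_smul_eq_mul, Real.norm_of_nonneg hθ.le]
          exact mul_le_of_le_one_right hθ.le hβ
        have h2 := hy _ hβ'
        have h3 := dotProduct_le_mul_dualNormRn hR hθ hβ' c
        rw [map_sub, LinearMap.sub_apply, pairing_opN, smul_dotProduct, smul_eq_mul] at h2
        rw [le_inv_mul_iff₀ hθ]
        linarith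
      have h2 := (hinfsup y hyK).trans h1
      rw [le_inv_mul_iff₀ hθ] at h2
      rw [hΔ]
      linarith
    have h1 := hy α hα
    have h2 := hviol y hyK
    have h3 : pB (opN A x α - b) y = -pB (-opN A x α + b) y := by
      rw [← LinearMap.neg_apply, ← map_neg]
      congr 2
      abel
    have h4 : dualNorm pB y ≤ (θP * dualNormRn R c - v) / Δ := (le_div_iff₀ hΔ0).2 hnorm
    have h5 := mul_le_mul_of_nonneg_left h4 hs
    rw [le_div_iff₀ (by positivity)]
    have h6 : s * ((θP * dualNormRn R c - v) / Δ)
        = s * (θP * dualNormRn R c / Δ) - v * (s / Δ) := by ring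
    rw [h6] at h5
    linarith
  have hJle := le_of_forall_lt_imp_le_of_dense hstep
  rw [le_div_iff₀ (by positivity)] at hJle
  have h7 : thetaD R c θP γ JLB ‖b‖ * s
      = s * (θP * dualNormRn R c / Δ) - JLB * (s / Δ) := by
    rw [thetaD]
    ring
  have h8 : JLB * (s / Δ) ≤ J * (s / Δ) := mul_le_mul_of_nonneg_right hJLB (by positivity)
  rw [h7]
  linarith

theorem thetaD_nonneg {A : X →ₗ[ℝ] B} {x : Fin n → X}
    {K : PointedCone ℝ B} {b : B} {c : Fin n → ℝ}
    {R : Seminorm ℝ (Fin n → ℝ)} (hR : ∀ α, R α = 0 → α = 0) {θP : ℝ} (hθ : 0 < θP)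
    (hfeas : (semiFeasible A x K b R θP).Nonempty) {γ : ℝ}
    (hθP : ‖b‖ < γ * θP) {JLB : ℝ} (hJLB : JLB ≤ optValue c (semiFeasible A x K b R θP)) :
    0 ≤ thetaD R c θP γ JLB ‖b‖ := by
  obtain ⟨α, hα⟩ := hfeas
  have hbdd : BddBelow ((fun α => α ⬝ᵥ c) '' semiFeasible A x K b R θP) := by
    refine ((Seminorm.isCompact_le hR θP).image (f := fun α => α ⬝ᵥ c)
      (by fun_prop)).bddBelow.mono ?_
    exact image_mono fun α hα => hα.2
  have h1 : optValue c (semiFeasible A x K b R θP) ≤ α ⬝ᵥ c := csInf_le hbdd ⟨α, hα, rfl⟩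
  have h2 := dotProduct_le_mul_dualNormRn hR hθ hα.2 c
  exact div_nonneg (by linarith) (by linarith)

end Duality

/-! ### The approximation error -/

theorem hasProbAtLeast_of_measure_compl_le {Ω : Type*} [MeasurableSpace Ω] {μ : Measure Ω}
    [IsProbabilityMeasure μ] {S : Set Ω} {β : ℝ} (hβ : 0 ≤ β)
    (h : μ Sᶜ ≤ ENNReal.ofReal β) : HasProbAtLeast μ S (1 - β) := by
  refine ⟨(toMeasurable μ Sᶜ)ᶜ, compl_subset_comm.1 (subset_toMeasurable μ Sᶜ),
    (measurableSet_toMeasurable μ Sᶜ).compl, ?_⟩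
  rw [prob_compl_eq_one_sub (measurableSet_toMeasurable μ Sᶜ), measure_toMeasurable,
    ENNReal.ofReal_sub _ hβ, ENNReal.ofReal_one]
  exact tsub_le_tsub_left h 1

/-- The binomial tail decreases in `N`, so the requirement met by the least sample size is met by
all larger ones. -/
theorem binomTail_le_of_sampleSize_le {n N : ℕ} {ε β : ℝ} (h0 : 0 ≤ ε) (h1 : ε ≤ 1)
    (h : sampleSize n ε β ≤ N) : binomTail n N ε ≤ β := by
  by_contra! hlt
  have h2 : ((N + 1 : ℕ) : ℕ∞) ≤ sampleSize n ε β := by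
    refine le_iInf₂ fun M hM => ?_
    have hM' : binomTail n M ε ≤ β := hM
    by_contra! hMN
    have h3 : M ≤ N := Nat.lt_succ_iff.1 (by exact_mod_cast hMN)
    exact absurd ((binomTail_antitone n h0 h1 h3).trans hM') (not_le.2 hlt)
  have h3 : ((N + 1 : ℕ) : ℕ∞) ≤ N := h2.trans h
  have h4 : N + 1 ≤ N := by exact_mod_cast h3
  omega

theorem strictConvexOn_dotProduct_self {n : ℕ} :
    StrictConvexOn ℝ univ fun α : Fin n → ℝ => α ⬝ᵥ α := by
  refine ⟨convex_univ, fun x _ y _ hxy s t hs ht hst => ?_⟩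
  have hpos : 0 < (x - y) ⬝ᵥ (x - y) := by
    refine lt_of_le_of_ne (Finset.sum_nonneg fun i _ => mul_self_nonneg _) fun h => hxy ?_
    exact sub_eq_zero.1 (dotProduct_self_eq_zero.1 h.symm)
  have h1 : s * (x ⬝ᵥ x) + t * (y ⬝ᵥ y) - (s • x + t • y) ⬝ᵥ (s • x + t • y)
      = s * t * ((x - y) ⬝ᵥ (x - y)) := by
    have ht' : t = 1 - s := by linarith
    simp only [add_dotProduct, dotProduct_add, sub_dotProduct, dotProduct_sub, smul_dotProduct,
      dotProduct_smul, smul_eq_mul, dotProduct_comm y x, ht']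
    ring
  have h2 : 0 < s * t * ((x - y) ⬝ᵥ (x - y)) := by positivity
  simp only [smul_eq_mul]
  linarith

section Gap

variable {X B Y : Type*} [NormedAddCommGroup X] [NormedSpace ℝ X]
  [NormedAddCommGroup B] [NormedSpace ℝ B] [AddCommGroup Y] [Module ℝ Y] {n N : ℕ}
  {pB : B →ₗ[ℝ] Y →ₗ[ℝ] ℝ} {A : X →ₗ[ℝ] B} {x : Fin n → X} {K : PointedCone ℝ B} {b : B}
  {R : Seminorm ℝ (Fin n → ℝ)} {θP : ℝ}

theorem pairing_residual (α : Fin n → ℝ) (y : Y) :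
    pB (-opN A x α + b) y = pB b y - α ⬝ᵥ adjN pB A x y := by
  rw [map_add, map_neg, LinearMap.add_apply, LinearMap.neg_apply, pairing_opN]
  ring

theorem pairing_le_of_mem_semiFeasible {α : Fin n → ℝ} (hα : α ∈ semiFeasible A x K b R θP) {y : Y}
    (hy : y ∈ PointedCone.dual pB (K : Set B)) : pB b y ≤ α ⬝ᵥ adjN pB A x y := by
  have h1 : 0 ≤ pB (opN A x α - b) y := hy hα.1
  rw [map_sub, LinearMap.sub_apply, pairing_opN] at h1
  linarith

theorem isCompact_scenFeasible (hR : ∀ α, R α = 0 → α = 0) (ω : Fin N → Y) :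
    IsCompact (scenFeasible pB A x b R θP ω) := by
  have h : scenFeasible pB A x b R θP ω
      = {α | R α ≤ θP} ∩ ⋂ j, {α | pB b (ω j) ≤ α ⬝ᵥ adjN pB A x (ω j)} := by
    ext α
    simp [scenFeasible, and_comm]
  rw [h]
  exact (Seminorm.isCompact_le hR θP).inter_right
    (isClosed_iInter fun j => isClosed_le continuous_const (by fun_prop))

theorem semiFeasible_subset_scenFeasible {ω : Fin N → Y}
    (hω : ∀ j, ω j ∈ PointedCone.dual pB (K : Set B)) :
    semiFeasible A x K b R θP ⊆ scenFeasible pB A x b R θP ω :=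
  fun _ hα => ⟨fun j => pairing_le_of_mem_semiFeasible hα (hω j), hα.2⟩

theorem optValue_eq_of_isOptimizer {c : Fin n → ℝ} {S : Set (Fin n → ℝ)} {α : Fin n → ℝ}
    (h : IsOptimizer c S α) : optValue c S = α ⬝ᵥ c := by
  refine IsLeast.csInf_eq ⟨⟨α, h.1, rfl⟩, ?_⟩
  rintro _ ⟨β, hβ, rfl⟩
  exact h.2 β hβ

theorem optValue_scenFeasible_le (hR : ∀ α, R α = 0 → α = 0) (c : Fin n → ℝ)
    (hfeas : (semiFeasible A x K b R θP).Nonempty) {ω : Fin N → Y}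
    (hω : ∀ j, ω j ∈ PointedCone.dual pB (K : Set B)) :
    optValue c (scenFeasible pB A x b R θP ω) ≤ optValue c (semiFeasible A x K b R θP) :=
  csInf_le_csInf ((isCompact_scenFeasible hR ω).image (f := fun α => α ⬝ᵥ c) (by fun_prop)).bddBelow
    (hfeas.image _) (image_mono (semiFeasible_subset_scenFeasible hω))

/-- The approximation error is controlled by the largest constraint violation over `𝒦`. -/
theorem optValue_sub_le_thetaD_mul (hpB : IsDualPair pB) (hK : IsWeaklyClosed pB (K : Set B))
    (hKcomp : IsWeaklyCompact pB.flip
      {y | y ∈ PointedCone.dual pB (K : Set B) ∧ dualNorm pB y ≤ 1})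
    {c : Fin n → ℝ} (hR : ∀ α, R α = 0 → α = 0) (hθ : 0 < θP)
    (hfeas : (semiFeasible A x K b R θP).Nonempty) {γ : ℝ}
    (hinfsup : ∀ y ∈ PointedCone.dual pB (K : Set B),
      γ * dualNorm pB y ≤ dualNormRn R (adjN pB A x y))
    (hθP : ‖b‖ < γ * θP) {JLB : ℝ} (hJLB : JLB ≤ optValue c (semiFeasible A x K b R θP))
    {ω : Fin N → Y} {α : Fin n → ℝ} (hα : IsOptimizer c (scenFeasible pB A x b R θP ω) α)
    {s : ℝ} (hs : 0 ≤ s) (hσ : supportFn pB (scenarioSet pB K) (-opN A x α + b) ≤ s) :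
    optValue c (semiFeasible A x K b R θP) - optValue c (scenFeasible pB A x b R θP ω)
      ≤ thetaD R c θP γ JLB ‖b‖ * s := by
  rw [optValue_eq_of_isOptimizer hα, sub_le_iff_le_add']
  exact optValue_le_add_thetaD_mul hpB A x hK b c hR hθ hfeas hinfsup hθP hJLB hα.1.2 hs
    fun y hy => hpB.pairing_le_mul_dualNorm hKcomp hs
      (fun z hz => (hpB.le_supportFn _ hz).trans hσ) hy

theorem norm_residual_le (hR : ∀ α, R α = 0 → α = 0) (hθ : 0 < θP)
    (hA : BddAbove (opNormValues A)) (hx : ∀ i, ‖x i‖ = 1) {α : Fin n → ℝ} (hα : R α ≤ θP) :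
    ‖-opN A x α + b‖ ≤ θP * ratioConst R * opNormSup A + ‖b‖ := by
  have h0 : 0 ≤ opNormSup A := by
    refine Real.sSup_nonneg ?_
    rintro _ ⟨v, -, rfl⟩
    exact norm_nonneg _
  have h1 := norm_opN_le hA hx α
  have h2 := mul_le_mul_of_nonneg_right (sum_abs_le_mul_ratioConst hR hθ hα) h0
  have h3 := norm_add_le (-opN A x α) b
  rw [norm_neg] at h3
  linarith

end Gap

/-- If the violation probability at `α` is at most `ε`, then a tail bound dominates the largest
violation over `𝒦`. -/
theorem IsTailBound.max_supportFn_le {X B Y : Type*} [NormedAddCommGroup X] [NormedSpace ℝ X]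
    [NormedAddCommGroup B] [NormedSpace ℝ B] [AddCommGroup Y] [Module ℝ Y] [MeasurableSpace Y]
    {n : ℕ} {pB : B →ₗ[ℝ] Y →ₗ[ℝ] ℝ} (hpB : IsDualPair pB) {A : X →ₗ[ℝ] B} {x : Fin n → X}
    {K : PointedCone ℝ B} {b : B} {P : Measure Y} [IsProbabilityMeasure P]
    (hP : ∀ᵐ y ∂P, y ∈ scenarioSet pB K) {h : (Fin n → ℝ) → ℝ → ℝ}
    (hh : IsTailBound pB A x K b P h) {α : Fin n → ℝ} {ε : ℝ} (hε : ε ∈ Ico (0 : ℝ) 1)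
    (hviol : P {y | α ⬝ᵥ adjN pB A x y < pB b y} ≤ ENNReal.ofReal ε) :
    max 0 (supportFn pB (scenarioSet pB K) (-opN A x α + b)) ≤ h α ε := by
  set σ := supportFn pB (scenarioSet pB K) (-opN A x α + b) with hσ
  have h0 : 0 ≤ h α ε := by
    refine hh α ε hε ⟨le_rfl, ?_⟩
    have hnull : P {y | σ < pB (-opN A x α + b) y + 0} = 0 := by
      refine measure_mono_null (t := {y | y ∉ scenarioSet pB K}) (fun y hy hyK => ?_) (ae_iff.1 hP)
      have hy' : σ < pB (-opN A x α + b) y + 0 := hy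
      have := hpB.le_supportFn (-opN A x α + b) hyK
      linarith
    rw [tailProb, measureReal_def, hnull]
    simpa using hε.1
  rcases le_total σ 0 with hneg | hpos
  · rwa [max_eq_left hneg]
  · rw [max_eq_right hpos]
    refine hh α ε hε ⟨hpos, ?_⟩
    refine ENNReal.toReal_le_of_le_ofReal hε.1 (le_trans (measure_mono fun y hy => ?_) hviol)
    have hy' : σ < pB (-opN A x α + b) y + σ := hy
    rw [pairing_residual] at hy'
    change α ⬝ᵥ adjN pB A x y < pB b y
    linarith

/-- If the violation at `α` exceeds `r L` somewhere on `𝒦`, where `L` bounds the norm of the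
residual, then the constraint is violated on a ball of radius `r`. -/
theorem IsBallBound.le_measure_violation {X B Y : Type*} [NormedAddCommGroup X] [NormedSpace ℝ X]
    [NormedAddCommGroup B] [NormedSpace ℝ B] [AddCommGroup Y] [Module ℝ Y] [MeasurableSpace Y]
    {n : ℕ} {pB : B →ₗ[ℝ] Y →ₗ[ℝ] ℝ} (hpB : IsDualPair pB) {A : X →ₗ[ℝ] B} {x : Fin n → X}
    {K : PointedCone ℝ B} {b : B} {P : Measure Y} {g : ℝ → ℝ} (hg : IsBallBound pB K P g)
    (hne : (scenarioSet pB K).Nonempty) {α : Fin n → ℝ} {r L : ℝ} (hr : 0 ≤ r)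
    (hL : ‖-opN A x α + b‖ ≤ L)
    (hσ : r * L < supportFn pB (scenarioSet pB K) (-opN A x α + b)) :
    ENNReal.ofReal (g r) ≤ P {y | α ⬝ᵥ adjN pB A x y < pB b y} := by
  obtain ⟨_, ⟨κ, hκ, rfl⟩, hlt⟩ := exists_lt_of_lt_csSup (hne.image _) hσ
  refine (hg.le_measure_ball κ hκ r hr).trans (measure_mono fun y hy => ?_)
  have hy' : dualNorm pB (y - κ) < r := hy
  have h1 := hpB.pairing_le (-(-opN A x α + b)) (y - κ)
  rw [norm_neg, map_neg, LinearMap.neg_apply, map_sub] at h1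
  have h2 : ‖-opN A x α + b‖ * dualNorm pB (y - κ) ≤ L * r :=
    mul_le_mul hL hy'.le (hpB.dualNorm_nonneg _) ((norm_nonneg _).trans hL)
  have h3 := pairing_residual (pB := pB) (A := A) (x := x) (b := b) α y
  change α ⬝ᵥ adjN pB A x y < pB b y
  simp only at hlt
  linarith

theorem scenarioSet_nonempty {B Y : Type*} [NormedAddCommGroup B] [NormedSpace ℝ B] [AddCommGroup Y]
    [Module ℝ Y] [MeasurableSpace Y] {pB : B →ₗ[ℝ] Y →ₗ[ℝ] ℝ} {K : PointedCone ℝ B} {P : Measure Y}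
    [IsProbabilityMeasure P] (hP : ∀ᵐ y ∂P, y ∈ scenarioSet pB K) : (scenarioSet pB K).Nonempty :=
  hP.exists

theorem mainTheorem2
    {X C B Y : Type*}
    [NormedAddCommGroup X] [NormedSpace ℝ X] [AddCommGroup C] [Module ℝ C]
    [NormedAddCommGroup B] [NormedSpace ℝ B] [AddCommGroup Y] [Module ℝ Y]
    -- the two dual pairs
    (pX : X →ₗ[ℝ] C →ₗ[ℝ] ℝ) (hpX : IsDualPair pX)
    (pB : B →ₗ[ℝ] Y →ₗ[ℝ] ℝ) (hpB : IsDualPair pB)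
    -- the data of the infinite linear program
    (A : X →ₗ[ℝ] B) (hA : IsWeaklyContinuous pX pB A)
    (K : PointedCone ℝ B) (hK : IsWeaklyClosed pB (K : Set B)) (b : B) (c : C)
    -- the dual cone meets the dual unit ball in a `σ(Y, B)`-compact set
    (hKcomp : IsWeaklyCompact pB.flip
      {y | y ∈ PointedCone.dual pB (K : Set B) ∧ dualNorm pB y ≤ 1})
    -- the basis elements, and the norm on `ℝⁿ`
    {n : ℕ} (x : Fin n → X) (hxlin : LinearIndependent ℝ x) (hxnorm : ∀ i, ‖x i‖ = 1)
    (R : Seminorm ℝ (Fin n → ℝ)) (hR : ∀ α, R α = 0 → α = 0) (θP : ℝ)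
    -- semi-infinite regularity
    (hfeas : (semiFeasible A x K b R θP).Nonempty)
    (γ : ℝ) (hγ : 0 < γ)
    (hinfsup : ∀ y ∈ PointedCone.dual pB (K : Set B),
      γ * dualNorm pB y ≤ dualNormRn R (adjN pB A x y))
    (hθP : ‖b‖ < γ * θP)
    -- a lower bound of the optimal value `J_n`
    (JLB : ℝ) (hJLB : JLB ≤ optValue (costVec pX x c) (semiFeasible A x K b R θP))
    -- the sampling distribution, concentrated on `𝒦`
    [MeasurableSpace Y] (hmeas : ∀ d : B, Measurable fun y : Y => pB d y)
    (P : Measure Y) [IsProbabilityMeasure P] (hP : ∀ᵐ y ∂P, y ∈ scenarioSet pB K)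
    (β : ℝ) (hβ : β ∈ Ioo (0 : ℝ) 1) :
    -- a posteriori bound
    (∀ (h : (Fin n → ℝ) → ℝ → ℝ), IsTailBound pB A x K b P h →
      ∀ (φ : (Fin n → ℝ) → ℝ), StrictConvexOn ℝ univ φ →
      ∀ ε ∈ Ioo (0 : ℝ) 1, ∀ N : ℕ, sampleSize n ε β ≤ N →
      ∀ αN : (Fin N → Y) → (Fin n → ℝ),
        (∀ᵐ ω ∂(Measure.pi fun _ : Fin N => P),
          IsSelectedOptimizer φ (costVec pX x c) (scenFeasible pB A x b R θP ω) (αN ω)) →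
        HasProbAtLeast (Measure.pi fun _ : Fin N => P)
          {ω | 0 ≤ optValue (costVec pX x c) (semiFeasible A x K b R θP)
                - optValue (costVec pX x c) (scenFeasible pB A x b R θP ω) ∧
              optValue (costVec pX x c) (semiFeasible A x K b R θP)
                - optValue (costVec pX x c) (scenFeasible pB A x b R θP ω)
                ≤ thetaD R (costVec pX x c) θP γ JLB ‖b‖ * h (αN ω) ε}
          (1 - β)) ∧
    -- a priori bound
    (∀ (g : ℝ → ℝ), IsBallBound pB K P g → BddAbove (opNormValues A) →
      ∀ ε : ℝ, 0 < ε → ∀ N : ℕ,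
        sampleSize n
          (g ((thetaD R (costVec pX x c) θP γ JLB ‖b‖
            * (θP * ratioConst R * opNormSup A + ‖b‖))⁻¹ * ε)) β ≤ N →
        HasProbAtLeast (Measure.pi fun _ : Fin N => P)
          {ω | 0 ≤ optValue (costVec pX x c) (semiFeasible A x K b R θP)
                - optValue (costVec pX x c) (scenFeasible pB A x b R θP ω) ∧
              optValue (costVec pX x c) (semiFeasible A x K b R θP)
                - optValue (costVec pX x c) (scenFeasible pB A x b R θP ω) ≤ ε}
          (1 - β)) := by
  have hθ : 0 < θP := by
    have h1 : 0 < γ * θP := (norm_nonneg b).trans_lt hθP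
    exact pos_of_mul_pos_right h1 hγ.le
  have hne := scenarioSet_nonempty hP
  have hdual : ∀ y ∈ scenarioSet pB K, y ∈ PointedCone.dual pB (K : Set B) :=
    fun y hy => (mem_extremePoints.1 hy).1.1
  have hn : 0 < n := by
    rcases Nat.eq_zero_or_pos n with rfl | h
    · exfalso
      obtain ⟨y, hy⟩ := hne
      have h1 := hinfsup y (hdual y hy)
      have h2 : dualNormRn R (adjN pB A x y) ≤ 0 := dualNormRn_le fun α _ => by simp
      rw [(mem_extremePoints.1 hy).1.2] at h1
      linarith
    · exact h
  have hpos := thetaD_nonneg hR hθ hfeas hθP hJLB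
  have hDc : IsCompact {α | R α ≤ θP} := Seminorm.isCompact_le hR θP
  have hD : Convex ℝ {α | R α ≤ θP} := by
    simpa using R.convexOn.convex_le θP
  have ha : Measurable (adjN pB A x) := measurable_pi_iff.2 fun i => hmeas (A (x i))
  obtain ⟨α₀, hα₀⟩ := id hfeas
  have hfeas_ae : ∀ᵐ y ∂P, pB b y ≤ α₀ ⬝ᵥ adjN pB A x y := by
    filter_upwards [hP] with y hy using pairing_le_of_mem_semiFeasible hα₀ (hdual y hy)
  have hall : ∀ N, ∀ᵐ ω ∂(Measure.pi fun _ : Fin N => P), ∀ j, ω j ∈ scenarioSet pB K :=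
    fun N => ae_all_iff.2 fun j =>
      (measurePreserving_eval (fun _ : Fin N => P) j).quasiMeasurePreserving.ae hP
  -- a sample size that meets the requirement is at least `n`, and `ε = 0` never meets it
  have hsize : ∀ {e : ℝ} {N : ℕ}, 0 ≤ e → e ≤ 1 → sampleSize n e β ≤ N →
      binomTail n N e ≤ β ∧ n ≤ N ∧ 0 < e := by
    intro e N he0 he1 hN
    have h1 := binomTail_le_of_sampleSize_le he0 he1 hN
    refine ⟨h1, ?_, lt_of_le_of_ne he0 fun h => ?_⟩
    · by_contra! hlt
      rw [binomTail_of_lt hlt] at h1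
      linarith [hβ.2]
    · rw [← h, binomTail_zero hn] at h1
      linarith [hβ.2]
  refine ⟨?_, ?_⟩
  · intro h hh φ hφ ε hε N hN αN hαN
    obtain ⟨hT, hnN, -⟩ := hsize hε.1.le hε.2.le hN
    refine hasProbAtLeast_of_measure_compl_le hβ.1.le ?_
    refine le_trans (measure_mono_ae ?_) ((measure_violation_lt_le P hn hDc hD ha (hmeas b) hα₀.2
      hfeas_ae (costVec pX x c) hφ hnN hαN hε.1.le hε.2.le).trans (ENNReal.ofReal_le_ofReal hT))
    filter_upwards [hall N, hαN] with ω hωK hsel hbad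
    by_contra hviol
    refine hbad ⟨?_, ?_⟩
    · exact sub_nonneg.2 (optValue_scenFeasible_le hR _ hfeas fun j => hdual _ (hωK j))
    · have h1 := hh.max_supportFn_le hpB hP ⟨hε.1.le, hε.2⟩ (not_lt.1 hviol)
      exact (optValue_sub_le_thetaD_mul hpB hK hKcomp hR hθ hfeas hinfsup hθP hJLB hsel.1
        (le_max_left _ _) (le_max_right _ _)).trans (mul_le_mul_of_nonneg_left h1 hpos)
  · intro g hg hAbdd ε hε N hN
    set c' := costVec pX x c with hc'
    set θD := thetaD R c' θP γ JLB ‖b‖ with hθD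
    set L := θP * ratioConst R * opNormSup A + ‖b‖ with hL
    have hL0 : 0 ≤ L := by
      refine (norm_nonneg _).trans (norm_residual_le (x := x) (b := b) hR hθ hAbdd hxnorm hα₀.2)
    set r := (θD * L)⁻¹ * ε with hr
    have hr0 : 0 ≤ r := by positivity
    have hgr := hg.mem_Icc r hr0
    obtain ⟨hT, hnN, hgpos⟩ := hsize hgr.1 hgr.2 hN
    -- an open ball of radius zero is empty, so `g 0 = 0`
    have hrpos : 0 < r := by
      refine lt_of_le_of_ne hr0 fun h0 => ?_
      obtain ⟨κ, hκ⟩ := hne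
      have h1 := hg.le_measure_ball κ hκ r hr0
      have h2 : {y | dualNorm pB (y - κ) < r} = ∅ := by
        refine eq_empty_of_forall_notMem fun y hy => ?_
        have hy' : dualNorm pB (y - κ) < r := hy
        rw [← h0] at hy'
        exact absurd (hpB.dualNorm_nonneg _) (not_le.2 hy')
      rw [h2, measure_empty, nonpos_iff_eq_zero, ENNReal.ofReal_eq_zero] at h1
      linarith
    have hθL : 0 < θD * L := by
      have h1 : 0 < (θD * L)⁻¹ := pos_of_mul_pos_left hrpos hε.le
      exact inv_pos.1 h1
    have hθD0 : 0 < θD := pos_of_mul_pos_left hθL hL0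
    have hrL : θD * (r * L) = ε := by
      calc θD * (r * L) = (θD * L)⁻¹ * (θD * L) * ε := by
            rw [hr]
            ring
        _ = ε := by rw [inv_mul_cancel₀ hθL.ne', one_mul]
    set φ : (Fin n → ℝ) → ℝ := fun α => α ⬝ᵥ α with hφ
    have hsel : ∀ᵐ ω ∂(Measure.pi fun _ : Fin N => P),
        ∃ α, IsSelectedOptimizer φ c' (scenFeasible pB A x b R θP ω) α := by
      filter_upwards [hall N] with ω hω
      exact exists_isSelectedOptimizer (by fun_prop) c' (isCompact_scenFeasible hR ω)
        ⟨α₀, semiFeasible_subset_scenFeasible (fun j => hdual _ (hω j)) hα₀⟩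
    obtain ⟨αN, hαN⟩ : ∃ αN : (Fin N → Y) → Fin n → ℝ, ∀ᵐ ω ∂(Measure.pi fun _ : Fin N => P),
        IsSelectedOptimizer φ c' (scenFeasible pB A x b R θP ω) (αN ω) := by
      refine ⟨fun ω => Classical.epsilon fun α =>
        IsSelectedOptimizer φ c' (scenFeasible pB A x b R θP ω) α, ?_⟩
      filter_upwards [hsel] with ω hω using Classical.epsilon_spec hω
    refine hasProbAtLeast_of_measure_compl_le hβ.1.le ?_
    refine le_trans (measure_mono_ae ?_) ((measure_violation_ge_le P hn hDc hD ha (hmeas b) hα₀.2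
      hfeas_ae c' strictConvexOn_dotProduct_self hnN hαN hgpos hgr.2).trans
        (ENNReal.ofReal_le_ofReal hT))
    filter_upwards [hall N, hαN] with ω hωK hsel hbad
    refine hg.le_measure_violation hpB hne hr0
      (norm_residual_le hR hθ hAbdd hxnorm hsel.1.1.2) ?_
    by_contra! hσ
    refine hbad ⟨?_, ?_⟩
    · exact sub_nonneg.2 (optValue_scenFeasible_le hR _ hfeas fun j => hdual _ (hωK j))
    · rw [← hrL]
      exact optValue_sub_le_thetaD_mul hpB hK hKcomp hR hθ hfeas hinfsup hθP hJLB hsel.1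
        (by positivity) hσ
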